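/- Let $n,p\ge 0$ be integers and let $V=\mathrm{Hom}(\mathbb C^n,\mathbb C^p)\oplus\mathrm{Hom}(\mathbb C^p,\mathbb C^n)$, on which $g\in\mathrm{GL}_n=\mathrm{GL}(\mathbb C^n)$ acts by $g\cdot(L\oplus\tilde L)=Lg^{-1}\oplus g\tilde L$. For a subgroup $G\subset\mathrm{GL}_n$ let $\mathcal O(V)^G$ be the algebra of $G$-invariant holomorphic functions $V\to\mathbb C$, and for a finite-dimensional complex vector space $W$ let $\mathcal O(W)$ be the algebra of holomorphic functions $W\to\mathbb C$. Put $U=\mathbb C^p\oplus(\mathbb C^p)^*$, with the bilinear forms $s(v\oplus\varphi,v'\oplus\varphi')=\varphi'(v)+\varphi(v')$ and $a(v\oplus\varphi,v'\oplus\varphi')=\varphi'(v)-\varphi(v')$, and for $b\in\{s,a\}$ let $\mathrm{Sym}_b(U)=\{w\in\mathrm{End}(U): b(wx,y)=b(x,wy)\ \text{for all } x,y\in U\}$. Consider the following three cases of a group $G$, a complex vector space $W$ and a $G$-invariant quadratic map $Q:V\to W$. (i) $G=\mathrm{GL}_n$, $W=\mathrm{End}(\mathbb C^p)$, $Q(L\oplus\tilde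 L)=L\tilde L$. (ii) $G=\mathrm{O}_n=\{g\in\mathrm{GL}_n: g^{\mathrm t}\beta g=\beta\}$, where $\beta:\mathbb C^n\to(\mathbb C^n)^*$ is any symmetric linear isomorphism ($\beta^{\mathrm t}=\beta$), $W=\mathrm{Sym}_s(U)$, and $$Q(L\oplus\tilde L)=\begin{pmatrix} L\tilde L & L\beta^{-1}L^{\mathrm t}\\ \tilde L^{\mathrm t}\beta\tilde L & \tilde L^{\mathrm t}L^{\mathrm t}\end{pmatrix}.$$ (iii) $G=\mathrm{Sp}_n=\{g\in\mathrm{GL}_n: g^{\mathrm t}\beta g=\beta\}$, where $\beta:\mathbb C^n\to(\mathbb C^n)^*$ is any alternating linear isomorphism ($\beta^{\mathrm t}=-\beta$, so that $n$ is even), $W=\mathrm{Sym}_a(U)$, and $Q$ is given by the same formula as in (ii). Then in each of the three cases $Q$ maps into $W$ and is $G$-invariant, and the algebra homomorphism $Q^*:\mathcal O(W)\to\mathcal O(V)^G$, $F\mapsto F\circ Q$, is surjective. -/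

import Mathlib

open Matrix
open scoped Matrix.Norms.Elementwise

/-- The algebra `𝒪(E)` of holomorphic (that is, everywhere complex differentiable) functions on a
complex normed space `E`. -/
def Hol (E : Type) [NormedAddCommGroup E] [NormedSpace ℂ E] : Subalgebra ℂ (E → ℂ) where
  carrier := {f | Differentiable ℂ f}
  mul_mem' hf hg := Differentiable.mul hf hg
  add_mem' hf hg := Differentiable.add hf hg
  algebraMap_mem' c := differentiable_const c

/-- `V = Hom(ℂⁿ, ℂᵖ) ⊕ Hom(ℂᵖ, ℂⁿ)`, a linear map being identified with its matrix in the standard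
bases.  An element is a pair `(L, L̃)`. -/
abbrev VSpace (n p : ℕ) : Type := Matrix (Fin p) (Fin n) ℂ × Matrix (Fin n) (Fin p) ℂ

/-- The action `g . (L ⊕ L̃) = L g⁻¹ ⊕ g L̃` of `GL_n` on `V`. -/
def gact {n p : ℕ} (g : GL (Fin n) ℂ) (v : VSpace n p) : VSpace n p :=
  (v.1 * (↑g⁻¹ : Matrix (Fin n) (Fin n) ℂ), (g : Matrix (Fin n) (Fin n) ℂ) * v.2)

/-- The algebra `𝒪(V)^G` of `G`-invariant holomorphic functions on `V`. -/
def HolInv {n : ℕ} (G : Subgroup (GL (Fin n) ℂ)) (p : ℕ) : Subalgebra ℂ (VSpace n p → ℂ) where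
  carrier := {f | f ∈ Hol (VSpace n p) ∧ ∀ g ∈ G, ∀ v, f (gact g v) = f v}
  mul_mem' := by
    rintro a b ⟨ha, ha'⟩ ⟨hb, hb'⟩
    exact ⟨mul_mem ha hb, fun g hg v => by simp [ha' g hg v, hb' g hg v]⟩
  add_mem' := by
    rintro a b ⟨ha, ha'⟩ ⟨hb, hb'⟩
    exact ⟨add_mem ha hb, fun g hg v => by simp [ha' g hg v, hb' g hg v]⟩
  algebraMap_mem' c := ⟨(Hol (VSpace n p)).algebraMap_mem c, fun _ _ _ => rfl⟩

/-- The pullback homomorphism `F ↦ F ∘ q`, `𝒪(W) → 𝒪(V)^G`, along a `G`-invariant holomorphic map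
`q : V → W`. -/
noncomputable def pullback {n p : ℕ} (G : Subgroup (GL (Fin n) ℂ)) {W : Type} [NormedAddCommGroup W]
    [NormedSpace ℂ W] (q : VSpace n p → W) (hq : Differentiable ℂ q)
    (hinv : ∀ g ∈ G, ∀ v, q (gact g v) = q v) : Hol W →ₐ[ℂ] HolInv G p where
  toFun F := ⟨fun v => (F : W → ℂ) (q v),
    Differentiable.comp F.2 hq, fun g hg v => by simp only [hinv g hg v]⟩
  map_one' := rfl
  map_mul' _ _ := rfl
  map_zero' := rfl
  map_add' _ _ := rfl
  commutes' _ := rfl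

/-- The isometry group `{g ∈ GL_n | gᵗ β g = β}` of the bilinear form with Gram matrix `β`: it is
`O_n` for `β` symmetric and `Sp_n` for `β` alternating (`β` non-degenerate). -/
def isomGroup {n : ℕ} (β : Matrix (Fin n) (Fin n) ℂ) : Subgroup (GL (Fin n) ℂ) where
  carrier := {g | (g : Matrix (Fin n) (Fin n) ℂ)ᵀ * β * (g : Matrix (Fin n) (Fin n) ℂ) = β}
  one_mem' := by simp
  mul_mem' := by
    intro a b ha hb
    simp only [Set.mem_ofPred_eq, Units.val_mul, transpose_mul] at *
    calc _ = (b : Matrix (Fin n) (Fin n) ℂ)ᵀ *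
          ((a : Matrix (Fin n) (Fin n) ℂ)ᵀ * β * (a : Matrix (Fin n) (Fin n) ℂ)) *
          (b : Matrix (Fin n) (Fin n) ℂ) := by simp only [Matrix.mul_assoc]
      _ = β := by rw [ha, hb]
  inv_mem' := by
    intro a ha
    simp only [Set.mem_ofPred_eq] at *
    have h1 : (a : Matrix (Fin n) (Fin n) ℂ) * (↑a⁻¹ : Matrix (Fin n) (Fin n) ℂ) = 1 :=
      Units.mul_inv a
    have h2 : (↑a⁻¹ : Matrix (Fin n) (Fin n) ℂ)ᵀ * (a : Matrix (Fin n) (Fin n) ℂ)ᵀ = 1 := by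
      rw [← transpose_mul, h1, transpose_one]
    calc _ = (↑a⁻¹ : Matrix (Fin n) (Fin n) ℂ)ᵀ *
          ((a : Matrix (Fin n) (Fin n) ℂ)ᵀ * β * (a : Matrix (Fin n) (Fin n) ℂ)) *
          (↑a⁻¹ : Matrix (Fin n) (Fin n) ℂ) := by rw [ha]
      _ = ((↑a⁻¹ : Matrix (Fin n) (Fin n) ℂ)ᵀ * (a : Matrix (Fin n) (Fin n) ℂ)ᵀ) * β *
          ((a : Matrix (Fin n) (Fin n) ℂ) * (↑a⁻¹ : Matrix (Fin n) (Fin n) ℂ)) := by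
          simp only [Matrix.mul_assoc]
      _ = β := by rw [h1, h2, Matrix.one_mul, Matrix.mul_one]

/-- Gram matrix of the symmetric form `s(v ⊕ φ, v' ⊕ φ') = φ'(v) + φ(v')` on `U = ℂᵖ ⊕ (ℂᵖ)*`, in
the standard basis of `ℂᵖ` followed by its dual basis. -/
def formS (p : ℕ) : Matrix (Fin p ⊕ Fin p) (Fin p ⊕ Fin p) ℂ := fromBlocks 0 1 1 0

/-- Gram matrix of the alternating form `a(v ⊕ φ, v' ⊕ φ') = φ'(v) - φ(v')` on
`U = ℂᵖ ⊕ (ℂᵖ)*`. -/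
def formA (p : ℕ) : Matrix (Fin p ⊕ Fin p) (Fin p ⊕ Fin p) ℂ := fromBlocks 0 1 (-1) 0

/-- `Sym_b(U)`: the endomorphisms `L` of `U` with `b(L x, y) = b(x, L y)` for all `x`, `y`, where
`b(x, y) = xᵗ J y`. -/
def SymB {p : ℕ} (J : Matrix (Fin p ⊕ Fin p) (Fin p ⊕ Fin p) ℂ) :
    Submodule ℂ (Matrix (Fin p ⊕ Fin p) (Fin p ⊕ Fin p) ℂ) where
  carrier := {L | ∀ x y : Fin p ⊕ Fin p → ℂ, (L *ᵥ x) ⬝ᵥ (J *ᵥ y) = x ⬝ᵥ (J *ᵥ (L *ᵥ y))}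
  zero_mem' := by intro x y; simp
  add_mem' := by
    intro a b ha hb x y
    simp only [add_mulVec, add_dotProduct, mulVec_add, dotProduct_add, ha x y, hb x y]
  smul_mem' := by
    intro c a ha x y
    simp only [smul_mulVec, smul_dotProduct, mulVec_smul, dotProduct_smul, ha x y]

theorem mem_SymB_iff {p : ℕ} (J L : Matrix (Fin p ⊕ Fin p) (Fin p ⊕ Fin p) ℂ) :
    L ∈ SymB J ↔ Lᵀ * J = J * L := by
  have key : ∀ x y : Fin p ⊕ Fin p → ℂ,
      (L *ᵥ x) ⬝ᵥ (J *ᵥ y) = x ⬝ᵥ ((Lᵀ * J) *ᵥ y) := by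
    intro x y
    rw [← vecMul_transpose, ← dotProduct_mulVec, mulVec_mulVec]
  constructor
  · intro h
    refine Matrix.ext fun i j => ?_
    have := h (Pi.single i 1) (Pi.single j 1)
    rw [key, mulVec_mulVec] at this
    simpa using this
  · intro h x y
    rw [key, mulVec_mulVec, h]

/-- The quadratic map `Q : V → W = End(ℂᵖ)`, `L ⊕ L̃ ↦ L L̃`, for `G = GL_n`. -/
def QGL {n p : ℕ} (v : VSpace n p) : Matrix (Fin p) (Fin p) ℂ := v.1 * v.2

/-- The quadratic map `Q : V → End(U)` for `G = O_n, Sp_n`, with blocks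
`(L L̃, L β⁻¹ Lᵗ; L̃ᵗ β L̃, L̃ᵗ Lᵗ)`. -/
noncomputable def QMat {n p : ℕ} (β : Matrix (Fin n) (Fin n) ℂ) (v : VSpace n p) :
    Matrix (Fin p ⊕ Fin p) (Fin p ⊕ Fin p) ℂ :=
  fromBlocks (v.1 * v.2) (v.1 * β⁻¹ * v.1ᵀ) (v.2ᵀ * β * v.2) (v.2ᵀ * v.1ᵀ)

theorem differentiable_matrix_iff {E : Type} [NormedAddCommGroup E] [NormedSpace ℂ E]
    {m k : Type} [Fintype m] [Fintype k] {f : E → Matrix m k ℂ} :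
    Differentiable ℂ f ↔ ∀ i j, Differentiable ℂ (fun x => f x i j) := by
  constructor
  · intro h i j
    exact differentiable_pi.1 (differentiable_pi.1 h i) j
  · intro h
    exact differentiable_pi.2 fun i => differentiable_pi.2 fun j => h i j

theorem differentiable_matrix_mul {E : Type} [NormedAddCommGroup E] [NormedSpace ℂ E]
    {m k l : Type} [Fintype m] [Fintype k] [Fintype l]
    {f : E → Matrix m k ℂ} {g : E → Matrix k l ℂ}
    (hf : Differentiable ℂ f) (hg : Differentiable ℂ g) :
    Differentiable ℂ (fun x => f x * g x) := by
  rw [differentiable_matrix_iff] at *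
  intro i j
  simp only [Matrix.mul_apply]
  exact Differentiable.fun_sum fun c _ => (hf i c).mul (hg c j)

theorem differentiable_matrix_transpose {E : Type} [NormedAddCommGroup E] [NormedSpace ℂ E]
    {m k : Type} [Fintype m] [Fintype k] {f : E → Matrix m k ℂ} (hf : Differentiable ℂ f) :
    Differentiable ℂ (fun x => (f x)ᵀ) := by
  rw [differentiable_matrix_iff] at *
  exact fun i j => hf j i

theorem QGL_differentiable {n p : ℕ} : Differentiable ℂ (QGL (n := n) (p := p)) :=
  differentiable_matrix_mul differentiable_fst differentiable_snd

theorem gact_mul {n p : ℕ} (g : GL (Fin n) ℂ) (v : VSpace n p) :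
    (gact g v).1 * (gact g v).2 = v.1 * v.2 := by
  have h1 : (↑g⁻¹ : Matrix (Fin n) (Fin n) ℂ) * (g : Matrix (Fin n) (Fin n) ℂ) = 1 :=
    Units.inv_mul g
  calc _ = v.1 * ((↑g⁻¹ : Matrix (Fin n) (Fin n) ℂ) * (g : Matrix (Fin n) (Fin n) ℂ)) * v.2 := by
        simp only [gact, Matrix.mul_assoc]
    _ = _ := by rw [h1, Matrix.mul_one]

theorem QMat_differentiable {n p : ℕ} (β : Matrix (Fin n) (Fin n) ℂ) :
    Differentiable ℂ (QMat (p := p) β) := by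
  have h1 : Differentiable ℂ (fun v : VSpace n p => v.1) := differentiable_fst
  have h2 : Differentiable ℂ (fun v : VSpace n p => v.2) := differentiable_snd
  have A := differentiable_matrix_iff.1 (differentiable_matrix_mul h1 h2)
  have B := differentiable_matrix_iff.1 (differentiable_matrix_mul
    (differentiable_matrix_mul h1 (differentiable_const β⁻¹)) (differentiable_matrix_transpose h1))
  have C := differentiable_matrix_iff.1 (differentiable_matrix_mul
    (differentiable_matrix_mul (differentiable_matrix_transpose h2) (differentiable_const β)) h2)
  have D := differentiable_matrix_iff.1 (differentiable_matrix_mul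
    (differentiable_matrix_transpose h2) (differentiable_matrix_transpose h1))
  refine differentiable_matrix_iff.2 ?_
  rintro (i | i) (j | j)
  · exact A i j
  · exact B i j
  · exact C i j
  · exact D i j

theorem QMat_invariant {n p : ℕ} (β : Matrix (Fin n) (Fin n) ℂ) :
    ∀ g ∈ isomGroup β, ∀ v : VSpace n p, QMat β (gact g v) = QMat β v := by
  intro g hg v
  have hg' : (g : Matrix (Fin n) (Fin n) ℂ)ᵀ * β * (g : Matrix (Fin n) (Fin n) ℂ) = β := hg
  have hginv : (↑g⁻¹ : Matrix (Fin n) (Fin n) ℂ) * β⁻¹ * (↑g⁻¹ : Matrix (Fin n) (Fin n) ℂ)ᵀ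
      = β⁻¹ := by
    have := congrArg (fun M => M⁻¹) hg'
    simp only [Matrix.mul_inv_rev] at this
    rw [← Matrix.transpose_nonsing_inv, ← Matrix.coe_units_inv] at this
    rw [Matrix.mul_assoc]
    exact this
  have hA := gact_mul g v
  have hB : (gact g v).1 * β⁻¹ * (gact g v).1ᵀ = v.1 * β⁻¹ * v.1ᵀ := by
    calc _ = v.1 * ((↑g⁻¹ : Matrix (Fin n) (Fin n) ℂ) * β⁻¹ *
          (↑g⁻¹ : Matrix (Fin n) (Fin n) ℂ)ᵀ) * v.1ᵀ := by
          simp only [gact, transpose_mul, Matrix.mul_assoc]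
      _ = _ := by rw [hginv]
  have hC : (gact g v).2ᵀ * β * (gact g v).2 = v.2ᵀ * β * v.2 := by
    calc _ = v.2ᵀ * ((g : Matrix (Fin n) (Fin n) ℂ)ᵀ * β * (g : Matrix (Fin n) (Fin n) ℂ)) *
          v.2 := by simp only [gact, transpose_mul, Matrix.mul_assoc]
      _ = _ := by rw [hg']
  have hD : (gact g v).2ᵀ * (gact g v).1ᵀ = v.2ᵀ * v.1ᵀ := by
    rw [← transpose_mul, ← transpose_mul, hA]
  simp only [QMat, hA, hB, hC, hD]

theorem QMat_mem_S {n p : ℕ} {β : Matrix (Fin n) (Fin n) ℂ} (hs : βᵀ = β) (v : VSpace n p) :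
    QMat β v ∈ SymB (formS p) := by
  rw [mem_SymB_iff]
  simp [QMat, formS, fromBlocks_transpose, fromBlocks_multiply, Matrix.transpose_nonsing_inv, hs,
    Matrix.mul_assoc]

theorem QMat_mem_A {n p : ℕ} {β : Matrix (Fin n) (Fin n) ℂ} (ha : βᵀ = -β)
    (hβ : IsUnit β.det) (v : VSpace n p) :
    QMat β v ∈ SymB (formA p) := by
  have hi : (β⁻¹)ᵀ = -β⁻¹ := by
    rw [Matrix.transpose_nonsing_inv, ha]
    refine Matrix.inv_eq_right_inv ?_
    rw [neg_mul_neg, Matrix.mul_nonsing_inv _ hβ]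
  rw [mem_SymB_iff]
  simp [QMat, formA, fromBlocks_transpose, fromBlocks_multiply, ha, hi, Matrix.mul_assoc]

theorem differentiable_codRestrict {n p : ℕ} {M : Type} [NormedAddCommGroup M] [NormedSpace ℂ M]
    [FiniteDimensional ℂ M] (W : Submodule ℂ M) (f : VSpace n p → M) (h : ∀ v, f v ∈ W)
    (hf : Differentiable ℂ f) : Differentiable ℂ (fun v => (⟨f v, h v⟩ : W)) := by
  obtain ⟨π, hπ⟩ := W.subtype.exists_leftInverse_of_injective (LinearMap.ker_eq_bot.2
    W.subtype_injective)
  have : (fun v => (⟨f v, h v⟩ : W)) = fun v => LinearMap.toContinuousLinearMap π (f v) := by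
    funext v
    exact (LinearMap.congr_fun hπ ⟨f v, h v⟩).symm
  rw [this]
  exact (ContinuousLinearMap.differentiable _).comp hf

/-- `Q : V → W = Sym_s(U)` for `G = O_n`. -/
noncomputable def QO {n p : ℕ} (β : Matrix (Fin n) (Fin n) ℂ) (hs : βᵀ = β) (v : VSpace n p) :
    SymB (formS p) := ⟨QMat β v, QMat_mem_S hs v⟩

/-- `Q : V → W = Sym_a(U)` for `G = Sp_n`. -/
noncomputable def QSp {n p : ℕ} (β : Matrix (Fin n) (Fin n) ℂ) (ha : βᵀ = -β) (hβ : IsUnit β.det)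
    (v : VSpace n p) : SymB (formA p) := ⟨QMat β v, QMat_mem_A ha hβ v⟩

/-- `Q^* : 𝒪(W) → 𝒪(V)^G` for `G = GL_n`, `W = End(ℂᵖ)`. -/
noncomputable def QstarGL (n p : ℕ) :
    Hol (Matrix (Fin p) (Fin p) ℂ) →ₐ[ℂ] HolInv (⊤ : Subgroup (GL (Fin n) ℂ)) p :=
  pullback ⊤ QGL QGL_differentiable (fun g _ v => gact_mul g v)

/-- `Q^* : 𝒪(W) → 𝒪(V)^G` for `G = O_n`, `W = Sym_s(U)`. -/
noncomputable def QstarO {n : ℕ} (p : ℕ) (β : Matrix (Fin n) (Fin n) ℂ) (hs : βᵀ = β) :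
    Hol (SymB (formS p)) →ₐ[ℂ] HolInv (isomGroup β) p :=
  pullback (isomGroup β) (QO β hs)
    (differentiable_codRestrict _ _ (QMat_mem_S hs) (QMat_differentiable β))
    (fun g hg v => Subtype.ext (QMat_invariant β g hg v))

/-- `Q^* : 𝒪(W) → 𝒪(V)^G` for `G = Sp_n`, `W = Sym_a(U)`. -/
noncomputable def QstarSp {n : ℕ} (p : ℕ) (β : Matrix (Fin n) (Fin n) ℂ) (ha : βᵀ = -β) (hβ : IsUnit β.det) :
    Hol (SymB (formA p)) →ₐ[ℂ] HolInv (isomGroup β) p :=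
  pullback (isomGroup β) (QSp β ha hβ)
    (differentiable_codRestrict _ _ (QMat_mem_A ha hβ) (QMat_differentiable β))
    (fun g hg v => Subtype.ext (QMat_invariant β g hg v))

/-
Every entire function on `V` is an absolutely convergent sum `f = ∑ cⱼ ℓⱼ ^ dⱼ` of powers of linear
forms. Writing `ℓⱼ v = τ (Aⱼ v)` for an equivariant linear map `Aⱼ` into a C⋆-algebra carrying an
anti-involution `θ`, and averaging over the compact group `K` of unitaries with `θ u = u⋆` (the
unitary trick: `K` is a compact real form of `G`), one gets `f v = ∑ cⱼ hⱼ (Aⱼ v)` with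
`hⱼ A = ∫ τ (u A) ^ dⱼ du` an entire function invariant under `K`. Such an `h` is an entire function
of `θ A * A`: in polar form only the square roots of the eigenvalues of `θ A * A` matter, and `h` is
even in each of them; this function is obtained without choosing a root by averaging
`h (√(w² + M))` over a large circle `|w| = ρ`. Finally `θ (Aⱼ v) * Aⱼ v` depends only on `Q v`.
For an orthogonal or symplectic group the form is first moved to a unitary one.
-/

open Topology

section SeveralVariables

open MeasureTheory Metric Filter Topology

variable {E F : Type*} [NormedAddCommGroup E] [NormedSpace ℂ E]
  [NormedAddCommGroup F] [NormedSpace ℂ F]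

theorem norm_fderiv_le_of_norm_le {f : E → F} {x : E} {r C : ℝ} (hr : 0 < r)
    (hd : DifferentiableOn ℂ f (ball x r)) (hb : ∀ y ∈ ball x r, ‖f y‖ ≤ C) :
    ‖fderiv ℂ f x‖ ≤ 2 * C / r := by
  refine Complex.norm_fderiv_le_div_of_mapsTo_ball hd (fun y hy => ?_) hr
  rw [mem_closedBall, dist_eq_norm]
  linarith [norm_sub_le (f y) (f x), hb y hy, hb x (mem_ball_self hr)]

theorem norm_fderiv_le_of_norm_le_on_ball {f : E → F} {x₀ : E} {r C : ℝ} (hr : 0 < r)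
    (hd : DifferentiableOn ℂ f (ball x₀ r)) (hb : ∀ y ∈ ball x₀ r, ‖f y‖ ≤ C)
    {x : E} (hx : x ∈ ball x₀ (r / 2)) : ‖fderiv ℂ f x‖ ≤ 2 * C / (r / 2) := by
  have hsub : ball x (r / 2) ⊆ ball x₀ r :=
    ball_subset_ball' (by linarith [mem_ball.1 hx])
  exact norm_fderiv_le_of_norm_le (half_pos hr) (hd.mono hsub) fun y hy => hb y (hsub hy)

theorem differentiableAt_tsum_of_dominated [CompleteSpace F] {J : Type*} {H : J → E → F} {x₀ : E}
    {r : ℝ} (hr : 0 < r) (hd : ∀ j, DifferentiableOn ℂ (H j) (ball x₀ r)) {g : J → ℝ}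
    (hg : Summable g) (hb : ∀ j, ∀ x ∈ ball x₀ r, ‖H j x‖ ≤ g j) :
    DifferentiableAt ℂ (fun x => ∑' j, H j x) x₀ := by
  have hsub : ball x₀ (r / 2) ⊆ ball x₀ r := ball_subset_ball (by linarith)
  have hpre : IsPreconnected (ball x₀ (r / 2)) := by
    let : NormedSpace ℝ E := NormedSpace.restrictScalars ℝ ℂ E
    exact (convex_ball x₀ (r / 2)).isPreconnected
  refine (hasFDerivAt_tsum_of_isPreconnected (f' := fun j x => fderiv ℂ (H j) x)
    (u := fun j => 2 * g j / (r / 2)) ((hg.mul_left 2).div_const _) isOpen_ball hpre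
    (fun j x hx => ((hd j).differentiableAt (isOpen_ball.mem_nhds (hsub hx))).hasFDerivAt)
    (fun j x hx => norm_fderiv_le_of_norm_le_on_ball hr (hd j) (hb j) hx)
    (mem_ball_self (half_pos hr)) ?_ (mem_ball_self (half_pos hr))).differentiableAt
  exact .of_norm_bounded hg fun j => hb j x₀ (mem_ball_self hr)

theorem iteratedDeriv_eq_smul_circleAverage [CompleteSpace F] {f : ℂ → F}
    (hf : Differentiable ℂ f) (k : ℕ) (c : ℂ) :
    iteratedDeriv k f c =
      (k.factorial : ℂ) • Real.circleAverage (fun w => ((w - c) ^ k)⁻¹ • f w) c 1 := by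
  have hcauchy := hf.diffContOnCl.circleIntegral_one_div_sub_center_pow_smul (c := c) one_pos k
  have hk : (k.factorial : ℂ) ≠ 0 := mod_cast k.factorial_ne_zero
  simp only [one_div, pow_succ', mul_inv] at hcauchy
  rw [Real.circleAverage_eq_circleIntegral one_ne_zero]
  simp only [smul_smul]
  rw [hcauchy, smul_smul, ← mul_div_assoc, mul_assoc, inv_mul_cancel₀ Complex.two_pi_I_ne_zero,
    mul_one, div_self hk, one_smul]

variable [FiniteDimensional ℂ E] {Ω : Type*} [MeasurableSpace Ω] {μ : Measure Ω}

theorem aestronglyMeasurable_fderiv {H : E → Ω → F} {x₀ : E}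
    (hmeas : ∀ᶠ x in 𝓝 x₀, AEStronglyMeasurable (H x) μ)
    (hd : ∀ ω, DifferentiableAt ℂ (fun x => H x ω) x₀) :
    AEStronglyMeasurable (fun ω => fderiv ℂ (fun x => H x ω) x₀) μ := by
  have hdir : ∀ v : E, AEStronglyMeasurable (fun ω => fderiv ℂ (fun x => H x ω) x₀ v) μ := by
    intro v
    have hc : Tendsto (fun n : ℕ => ‖(n : ℂ)‖) atTop atTop := by
      simpa using tendsto_natCast_atTop_atTop (R := ℝ)
    have hx : Tendsto (fun n : ℕ => x₀ + (n : ℂ)⁻¹ • v) atTop (𝓝 x₀) := by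
      simpa using ((tendsto_inv_atTop_nhds_zero_nat (𝕜 := ℂ)).smul_const v).const_add x₀
    obtain ⟨N, hN⟩ := eventually_atTop.1 (hx.eventually hmeas)
    refine aestronglyMeasurable_of_tendsto_ae atTop (fun n => ?_) (.of_forall fun ω =>
      ((hd ω).hasFDerivAt.lim v hc).comp (tendsto_add_atTop_nat N))
    exact ((hN (n + N) (Nat.le_add_left N n)).sub hmeas.self_of_nhds).const_smul _
  let b := Module.finBasis ℂ E
  have hexp : (fun ω => fderiv ℂ (fun x => H x ω) x₀) = fun ω => ∑ i,
      ContinuousLinearMap.smulRightL ℂ E F (LinearMap.toContinuousLinearMap (b.coord i))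
        (fderiv ℂ (fun x => H x ω) x₀ (b i)) := by
    funext ω
    refine ContinuousLinearMap.coe_injective (b.ext fun j => ?_)
    simp [Finsupp.single_apply]
  rw [hexp]
  exact Finset.aestronglyMeasurable_fun_sum _ fun i _ =>
    (ContinuousLinearMap.continuous _).comp_aestronglyMeasurable (hdir (b i))

theorem differentiableAt_integral_of_dominated {H : E → Ω → F} {x₀ : E} {r : ℝ} (hr : 0 < r)
    (hmeas : ∀ x ∈ ball x₀ r, AEStronglyMeasurable (H x) μ)
    (hd : ∀ ω, DifferentiableOn ℂ (fun x => H x ω) (ball x₀ r)) {g : Ω → ℝ}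
    (hg : Integrable g μ) (hb : ∀ ω, ∀ x ∈ ball x₀ r, ‖H x ω‖ ≤ g ω) :
    DifferentiableAt ℂ (fun x => ∫ ω, H x ω ∂μ) x₀ := by
  have hdx : ∀ ω, ∀ x ∈ ball x₀ r, DifferentiableAt ℂ (fun x => H x ω) x := fun ω x hx =>
    (hd ω).differentiableAt (isOpen_ball.mem_nhds hx)
  have hmeas' : ∀ᶠ x in 𝓝 x₀, AEStronglyMeasurable (H x) μ :=
    eventually_of_mem (ball_mem_nhds x₀ hr) hmeas
  have hx₀ : x₀ ∈ ball x₀ r := mem_ball_self hr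
  exact (hasFDerivAt_integral_of_dominated_of_fderiv_le (ball_mem_nhds x₀ (half_pos hr)) hmeas'
    (hg.mono' (hmeas x₀ hx₀) (.of_forall fun ω => hb ω x₀ hx₀))
    (aestronglyMeasurable_fderiv hmeas' fun ω => hdx ω x₀ hx₀)
    (.of_forall fun ω x hx => norm_fderiv_le_of_norm_le_on_ball hr (hd ω) (hb ω) hx)
    ((hg.const_mul 2).div_const _)
    (.of_forall fun ω x hx =>
      (hdx ω x (ball_subset_ball (by linarith) hx)).hasFDerivAt)).differentiableAt

theorem differentiable_integral_of_continuous [TopologicalSpace Ω] [CompactSpace Ω]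
    [OpensMeasurableSpace Ω] [SecondCountableTopologyEither Ω F] [IsFiniteMeasure μ]
    {H : E → Ω → F} (hcont : Continuous (Function.uncurry H))
    (hd : ∀ ω, Differentiable ℂ fun x => H x ω) : Differentiable ℂ fun x => ∫ ω, H x ω ∂μ := by
  intro x₀
  have : ProperSpace E := FiniteDimensional.proper ℂ E
  obtain ⟨C, hC⟩ := ((isCompact_closedBall x₀ 1).prod isCompact_univ).exists_bound_of_continuousOn
    hcont.continuousOn
  exact differentiableAt_integral_of_dominated one_pos
    (fun x _ => (hcont.comp (.prodMk_right x)).aestronglyMeasurable)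
    (fun ω => (hd ω).differentiableOn) (integrable_const C)
    fun ω x hx => hC (x, ω) ⟨ball_subset_closedBall hx, Set.mem_univ ω⟩

theorem differentiableOn_circleAverage {H : E → ℂ → F} {U : Set E} (hU : IsOpen U) {c : ℂ} {ρ : ℝ}
    (hcont : ContinuousOn (Function.uncurry H) (U ×ˢ sphere c |ρ|))
    (hd : ∀ w ∈ sphere c |ρ|, DifferentiableOn ℂ (fun x => H x w) U) :
    DifferentiableOn ℂ (fun x => Real.circleAverage (H x) c ρ) U := by
  intro x₀ hx₀
  have : ProperSpace E := FiniteDimensional.proper ℂ E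
  obtain ⟨r, hr, hrU⟩ := nhds_basis_closedBall.mem_iff.1 (hU.mem_nhds hx₀)
  have hsub : ball x₀ r ⊆ U := ball_subset_closedBall.trans hrU
  have hmem : ∀ t, circleMap c ρ t ∈ sphere c |ρ| := circleMap_mem_sphere' c ρ
  obtain ⟨C, hC⟩ := ((isCompact_closedBall x₀ r).prod
    (isCompact_sphere c |ρ|)).exists_bound_of_continuousOn
      (hcont.mono (Set.prod_mono_left hrU))
  simp only [Real.circleAverage_def, intervalIntegral.integral_of_le Real.two_pi_pos.le]
  refine ((differentiableAt_integral_of_dominated hr (fun x hx => ?_)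
    (fun t => (hd _ (hmem t)).mono hsub) (integrable_const C) fun t x hx =>
      hC (x, _) ⟨ball_subset_closedBall hx, hmem t⟩).const_smul _).differentiableWithinAt
  exact (hcont.comp_continuous (continuous_const.prodMk (continuous_circleMap c ρ))
    fun t => ⟨hsub hx, hmem t⟩).aestronglyMeasurable

theorem differentiable_iteratedDeriv_slice [CompleteSpace F] {f : ℂ × E → F}
    (hf : Differentiable ℂ f) (k : ℕ) (c : ℂ) :
    Differentiable ℂ fun z => iteratedDeriv k (fun w => f (w, z)) c := by
  simp only [fun z => iteratedDeriv_eq_smul_circleAverage (f := fun w => f (w, z))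
    (hf.comp (differentiable_id.prodMk (differentiable_const z))) k c]
  refine (differentiableOn_univ.1
    (differentiableOn_circleAverage isOpen_univ ?_ fun w _ => ?_)).const_smul _
  · have hne : ∀ q ∈ Set.univ ×ˢ sphere c |(1 : ℝ)|, ((q : E × ℂ).2 - c) ^ k ≠ 0 := fun q hq =>
      pow_ne_zero k (sub_ne_zero.2 (ne_of_mem_sphere hq.2 (by simp)))
    exact (ContinuousOn.inv₀ (by fun_prop) hne).smul
      (hf.continuous.comp (continuous_snd.prodMk continuous_fst)).continuousOn
  · exact ((hf.comp ((differentiable_const w).prodMk differentiable_id)).const_smul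
      _).differentiableOn

end SeveralVariables

section Polarization

open Finset

variable {K : Type*} [Field K] {ω : K} {N : ℕ}

theorem sum_inv_pow_mul_pow_eq_ite (hω : IsPrimitiveRoot ω N) {k m : ℕ} (hk : k < N) (hm : m < N) :
    ∑ s ∈ range N, ((ω ^ s)⁻¹) ^ k * (ω ^ s) ^ m = if m = k then (N : K) else 0 := by
  have hω0 : ω ≠ 0 := hω.ne_zero (by omega)
  have hgeom : ∀ s, ((ω ^ s)⁻¹) ^ k * (ω ^ s) ^ m = ((ω ^ k)⁻¹ * ω ^ m) ^ s := fun s => by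
    rw [mul_pow, inv_pow, inv_pow, ← pow_mul, ← pow_mul, ← pow_mul, ← pow_mul, mul_comm s,
      mul_comm s]
  simp only [hgeom]
  split_ifs with h
  · simp [h, hω0]
  · have hne : (ω ^ k)⁻¹ * ω ^ m ≠ 1 := fun h1 =>
      h (hω.pow_inj hm hk ((inv_mul_eq_one₀ (pow_ne_zero k hω0)).1 h1).symm)
    have hpow : ((ω ^ k)⁻¹ * ω ^ m) ^ N = 1 := by
      rw [mul_pow, inv_pow, pow_right_comm, pow_right_comm ω m, hω.pow_eq_one]
      simp
    refine (mul_eq_zero.1 ?_).resolve_left (sub_ne_zero.2 hne.symm)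
    rw [mul_neg_geom_sum, hpow, sub_self]

theorem sum_inv_pow_mul_sum_eq (hω : IsPrimitiveRoot ω N) {k : ℕ} (hk : k < N) (a : ℕ → K) :
    ∑ s ∈ range N, ((ω ^ s)⁻¹) ^ k * ∑ m ∈ range N, a m * (ω ^ s) ^ m = N * a k := by
  simp only [mul_sum, mul_left_comm _ (a _)]
  rw [sum_comm]
  simp only [← mul_sum]
  rw [sum_congr rfl fun m hm => by rw [sum_inv_pow_mul_pow_eq_ite hω hk (mem_range.1 hm)]]
  simp [hk, mul_comm]

/-- The `(k + d + 1)`-st roots of unity, at which the polarization identity for `t ^ k * l ^ d`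
evaluates the powers `(u * t + l) ^ (k + d)`. -/
noncomputable def polarNode (k d : ℕ) (s : Fin (k + d + 1)) : ℂ :=
  Complex.exp (2 * Real.pi * Complex.I / ((k + d + 1 : ℕ) : ℂ)) ^ (s : ℕ)

/-- The weights of the polarization identity `sum_polarWeight_mul_pow`, obtained by inverting a
discrete Fourier transform. -/
noncomputable def polarWeight (k d : ℕ) (s : Fin (k + d + 1)) : ℂ :=
  ((k + d + 1 : ℕ) * (k + d).choose k : ℂ)⁻¹ * ((polarNode k d s)⁻¹) ^ k

theorem norm_polarNode (k d : ℕ) (s : Fin (k + d + 1)) : ‖polarNode k d s‖ = 1 := by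
  have hω := Complex.isPrimitiveRoot_exp (k + d + 1) (k + d).succ_ne_zero
  rw [polarNode, norm_pow,
    Complex.norm_eq_one_of_pow_eq_one hω.pow_eq_one (k + d).succ_ne_zero, one_pow]

theorem sum_norm_polarWeight_le_one (k d : ℕ) : ∑ s, ‖polarWeight k d s‖ ≤ 1 := by
  have hchoose : (1 : ℝ) ≤ (k + d).choose k := mod_cast Nat.choose_pos (by omega)
  have hb : ∀ s, ‖polarWeight k d s‖ = ((k + d + 1 : ℕ) * (k + d).choose k : ℝ)⁻¹ := fun s => by
    simp only [polarWeight, norm_mul, norm_inv, norm_pow, norm_polarNode, Complex.norm_natCast,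
      one_pow, inv_one, mul_one]
  rw [sum_congr rfl fun s _ => hb s, sum_const, card_univ, Fintype.card_fin, nsmul_eq_mul,
    mul_inv, mul_inv_cancel_left₀ (by positivity)]
  exact inv_le_one_of_one_le₀ hchoose

theorem sum_polarWeight_mul_pow (k d : ℕ) (t l : ℂ) :
    ∑ s, polarWeight k d s * (polarNode k d s * t + l) ^ (k + d) = t ^ k * l ^ d := by
  have hω := Complex.isPrimitiveRoot_exp (k + d + 1) (k + d).succ_ne_zero
  have hdft := sum_inv_pow_mul_sum_eq hω (k := k) (by omega)
    fun m => t ^ m * l ^ (k + d - m) * (k + d).choose m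
  have hexp : ∀ u : ℂ, (u * t + l) ^ (k + d) =
      ∑ m ∈ range (k + d + 1), t ^ m * l ^ (k + d - m) * (k + d).choose m * u ^ m := fun u => by
    rw [add_pow]
    exact sum_congr rfl fun m _ => by ring
  have hchoose : ((k + d).choose k : ℂ) ≠ 0 := mod_cast (Nat.choose_pos (by omega)).ne'
  have hcard : ((k + d + 1 : ℕ) : ℂ) ≠ 0 := Nat.cast_ne_zero.2 (k + d).succ_ne_zero
  simp only [← hexp, Nat.add_sub_cancel_left] at hdft
  simp only [polarWeight, mul_assoc (_⁻¹ : ℂ), ← mul_sum]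
  simp only [polarNode]
  rw [Fin.sum_univ_eq_sum_range fun s => ((_ ^ s)⁻¹) ^ k * (_ ^ s * t + l) ^ (k + d), hdft]
  field_simp

theorem hasSum_polarWeight_mul_pow (k d : ℕ) (c t l : ℂ) : HasSum
    (fun s => c * polarWeight k d s * (polarNode k d s * t + l) ^ (k + d))
    (t ^ k * (c * l ^ d)) := by
  rw [mul_left_comm, ← sum_polarWeight_mul_pow, Finset.mul_sum]
  simp only [mul_assoc]
  exact hasSum_fintype _

end Polarization

section PowerExpansions

open scoped ENNReal NNReal

variable {E E' : Type*} [NormedAddCommGroup E] [NormedSpace ℂ E]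
  [NormedAddCommGroup E'] [NormedSpace ℂ E']

theorem hasSum_pow_mul_iteratedDeriv_slice {f : ℂ × E → ℂ} (hf : Differentiable ℂ f)
    (p : ℂ × E) : HasSum (fun k : ℕ =>
      p.1 ^ k * ((k.factorial : ℂ)⁻¹ * iteratedDeriv k (fun w => f (w, p.2)) 0)) (f p) := by
  have hslice : Differentiable ℂ fun w => f (w, p.2) :=
    hf.comp (differentiable_id.prodMk (differentiable_const p.2))
  simpa [mul_left_comm, mul_assoc] using Complex.hasSum_taylorSeries_of_entire hslice 0 p.1

theorem norm_inv_factorial_mul_iteratedDeriv_le {f : ℂ → ℂ} (hf : Differentiable ℂ f)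
    {r M : ℝ} (hr : 0 < r) (hM : ∀ w, ‖w‖ ≤ r → ‖f w‖ ≤ M) (k : ℕ) :
    ‖(k.factorial : ℂ)⁻¹ * iteratedDeriv k f 0‖ ≤ M / r ^ k := by
  have h := Complex.norm_iteratedDeriv_le_of_forall_mem_sphere_norm_le k hr hf.diffContOnCl
    fun w hw => hM w (mem_sphere_zero_iff_norm.1 hw).le
  rw [norm_mul, norm_inv, Complex.norm_natCast, inv_mul_le_iff₀ (by positivity)]
  exact h.trans_eq (mul_div_assoc ..)

theorem exists_norm_le_of_norm_le [FiniteDimensional ℂ E] {F : Type*} [SeminormedAddCommGroup F]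
    {f : E → F} (hf : Continuous f) (r : ℝ) :
    ∃ M : ℝ≥0, ∀ v, ‖v‖ ≤ r → ‖f v‖ ≤ M := by
  have : ProperSpace E := FiniteDimensional.proper ℂ E
  obtain ⟨M, hM⟩ := (isCompact_closedBall (0 : E) r).exists_bound_of_continuousOn hf.continuousOn
  exact ⟨M.toNNReal, fun v hv => (hM v (mem_closedBall_zero_iff.2 hv)).trans M.le_coe_toNNReal⟩

/-- A countable family of terms `c * ℓ ^ d` with `ℓ` a continuous linear form on `E`; an entire
function will be represented as the sum of such a family. -/
structure PowerExpansion (E : Type*) [NormedAddCommGroup E] [NormedSpace ℂ E] where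
  Index : Type
  coeff : Index → ℂ
  form : Index → E →L[ℂ] ℂ
  degree : Index → ℕ
  countable_index : Countable Index

namespace PowerExpansion

attribute [instance] countable_index

/-- The sum of the absolute values of the terms of `P`, each linear form being replaced by its
bound `R`. -/
noncomputable def majorant (P : PowerExpansion E) (R : ℝ≥0) : ℝ≥0∞ :=
  ∑' j, ‖P.coeff j‖ₑ * (R : ℝ≥0∞) ^ P.degree j

/-- The terms of `P` sum up unconditionally to `f`. -/
def Represents (P : PowerExpansion E) (f : E → ℂ) : Prop :=
  ∀ v, HasSum (fun j => P.coeff j * P.form j v ^ P.degree j) (f v)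

theorem summable_of_majorant_ne_top {P : PowerExpansion E} {R : ℝ≥0} (hR : P.majorant R ≠ ∞) :
    Summable fun j => ‖P.coeff j‖ * (R : ℝ) ^ P.degree j := by
  have h : Summable fun j => ‖P.coeff j‖₊ * R ^ P.degree j :=
    ENNReal.tsum_coe_ne_top_iff_summable.1 (by simpa [majorant, enorm_eq_nnnorm] using hR)
  simpa using NNReal.summable_coe.2 h

theorem majorant_mono (P : PowerExpansion E) : Monotone P.majorant := by
  intro R S hRS
  simp only [majorant]
  gcongr

theorem summable_term {P : PowerExpansion E} {C : ℝ≥0} (hC : ∀ j, ‖P.form j‖ ≤ C) {v : E}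
    (hv : P.majorant (C * ‖v‖₊) ≠ ∞) :
    Summable fun j => P.coeff j * P.form j v ^ P.degree j := by
  refine .of_norm_bounded (summable_of_majorant_ne_top hv) fun j => ?_
  rw [norm_mul, norm_pow]
  gcongr
  exact (P.form j).le_of_opNorm_le (hC j) v

/-- The pullback of `P` along `e`. -/
noncomputable def comp (P : PowerExpansion E) (e : E' →L[ℂ] E) : PowerExpansion E' where
  Index := P.Index
  coeff := P.coeff
  form j := (P.form j).comp e
  degree := P.degree
  countable_index := inferInstance

/-- The terms of `∑ k, t ^ k * P k`, rewritten as powers of linear forms by polarization. -/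
noncomputable def cons (P : ℕ → PowerExpansion E) : PowerExpansion (ℂ × E) where
  Index := Σ i : Σ k, (P k).Index, Fin (i.1 + (P i.1).degree i.2 + 1)
  coeff i := (P i.1.1).coeff i.1.2 * polarWeight i.1.1 ((P i.1.1).degree i.1.2) i.2
  form i := polarNode i.1.1 ((P i.1.1).degree i.1.2) i.2 • ContinuousLinearMap.fst ℂ ℂ E +
    ((P i.1.1).form i.1.2).comp (ContinuousLinearMap.snd ℂ ℂ E)
  degree i := i.1.1 + (P i.1.1).degree i.1.2
  countable_index := inferInstance

variable {P : ℕ → PowerExpansion E} {C : ℝ≥0}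

theorem norm_form_cons_le (hC : ∀ k j, ‖(P k).form j‖ ≤ C) (i : (cons P).Index) :
    ‖(cons P).form i‖ ≤ (1 + C : ℝ≥0) := by
  refine (norm_add_le _ _).trans (add_le_add ?_ ?_)
  · rw [norm_smul, norm_polarNode, one_mul]
    exact ContinuousLinearMap.norm_fst_le ..
  · exact (ContinuousLinearMap.opNorm_comp_le _ _).trans ((mul_le_of_le_one_right (norm_nonneg _)
      (ContinuousLinearMap.norm_snd_le ..)).trans (hC _ _))

theorem majorant_cons_le (P : ℕ → PowerExpansion E) (R : ℝ≥0) :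
    (cons P).majorant R ≤ ∑' k, (R : ℝ≥0∞) ^ k * (P k).majorant R := by
  have hsum : ∀ k d, ∑ s, ‖polarWeight k d s‖ₑ ≤ 1 := fun k d => by
    simp only [enorm_eq_nnnorm]
    exact_mod_cast NNReal.coe_le_coe.1 (by simpa using sum_norm_polarWeight_le_one k d)
  calc (cons P).majorant R
    _ = ∑' (k) (j : (P k).Index) (s), ‖(P k).coeff j * polarWeight k ((P k).degree j) s‖ₑ *
          (R : ℝ≥0∞) ^ (k + (P k).degree j) := by
      exact (ENNReal.tsum_sigma' _).trans (ENNReal.tsum_sigma' _)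
    _ = ∑' (k) (j), ‖(P k).coeff j‖ₑ * (∑ s, ‖polarWeight k ((P k).degree j) s‖ₑ) *
          (R : ℝ≥0∞) ^ (k + (P k).degree j) := by
      simp only [tsum_fintype, enorm_mul, ← Finset.sum_mul, ← Finset.mul_sum]
    _ ≤ ∑' (k) (j), ‖(P k).coeff j‖ₑ * 1 * (R : ℝ≥0∞) ^ (k + (P k).degree j) := by
      gcongr
      exact hsum _ _
    _ = ∑' k, (R : ℝ≥0∞) ^ k * (P k).majorant R := by
      simp only [majorant, ← ENNReal.tsum_mul_left, mul_one, pow_add, mul_left_comm]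

theorem form_cons_apply (i : (cons P).Index) (p : ℂ × E) : (cons P).form i p =
    polarNode i.1.1 ((P i.1.1).degree i.1.2) i.2 * p.1 + (P i.1.1).form i.1.2 p.2 :=
  rfl

theorem hasSum_sigma_of_hasSum_cons {p : ℂ × E} {S : ℂ}
    (hS : HasSum (fun i => (cons P).coeff i * (cons P).form i p ^ (cons P).degree i) S) :
    HasSum (fun i : Σ k, (P k).Index =>
      p.1 ^ i.1 * ((P i.1).coeff i.2 * (P i.1).form i.2 p.2 ^ (P i.1).degree i.2)) S := by
  simp only [form_cons_apply] at hS
  exact HasSum.sigma hS fun i => hasSum_polarWeight_mul_pow i.1 ((P i.1).degree i.2)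
    ((P i.1).coeff i.2) p.1 ((P i.1).form i.2 p.2)

theorem represents_cons {f : ℂ × E → ℂ} {g : ℕ → E → ℂ}
    (hf : ∀ p : ℂ × E, HasSum (fun k => p.1 ^ k * g k p.2) (f p))
    (hP : ∀ k, (P k).Represents (g k)) (hC : ∀ k j, ‖(P k).form j‖ ≤ C)
    (hfin : ∀ R, (cons P).majorant R ≠ ∞) : (cons P).Represents f := by
  intro p
  obtain ⟨S, hS⟩ := summable_term (norm_form_cons_le hC) (v := p) (hfin _)
  have hk : ∀ k, HasSum (fun j => p.1 ^ k * ((P k).coeff j * (P k).form j p.2 ^ (P k).degree j))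
      (p.1 ^ k * g k p.2) := fun k => (hP k p.2).mul_left _
  have hsum : HasSum (fun k => p.1 ^ k * g k p.2) S :=
    (hasSum_sigma_of_hasSum_cons hS).sigma hk
  rwa [(hf p).unique hsum]

theorem majorant_cons_le_of_forall {R B M : ℝ≥0} (hR : 0 < R)
    (h : ∀ k, (P k).majorant R ≤ B * (M / (2 * R) ^ k : ℝ≥0)) :
    (cons P).majorant R ≤ (2 * B : ℝ≥0) * M := by
  have hgeom : ∀ k : ℕ, R ^ k * (B * (M / (2 * R) ^ k)) = B * M * 2⁻¹ ^ k := fun k => by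
    rw [mul_pow, inv_pow]
    field_simp
  calc (cons P).majorant R
    _ ≤ ∑' k, (R : ℝ≥0∞) ^ k * (B * (M / (2 * R) ^ k : ℝ≥0)) :=
      (majorant_cons_le P R).trans (by gcongr; exact h _)
    _ = ∑' k, (B * M * 2⁻¹ ^ k : ℝ≥0∞) := by
      refine tsum_congr fun k => ?_
      rw [← ENNReal.coe_ofNat, ← ENNReal.coe_inv two_ne_zero]
      exact_mod_cast hgeom k
    _ = (2 * B : ℝ≥0) * M := by
      rw [ENNReal.tsum_mul_left, ENNReal.tsum_geometric, ENNReal.one_sub_inv_two, inv_inv]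
      push_cast
      ring

theorem majorant_ne_top_of_forall_pos (P : PowerExpansion E)
    (h : ∀ R : ℝ≥0, 0 < R → P.majorant R ≠ ∞) (R : ℝ≥0) : P.majorant R ≠ ∞ :=
  ne_top_of_le_ne_top (h (R + 1) (by positivity)) (P.majorant_mono (by simp))

end PowerExpansion

open PowerExpansion

/-- The property that all entire functions on `E` are sums of powers of uniformly bounded linear
forms, with majorants controlled by the function on balls; the dimension of `E` enters through the
constants. -/
def HasPowerExpansions (E : Type*) [NormedAddCommGroup E] [NormedSpace ℂ E] : Prop :=
  ∃ C Λ B : ℝ≥0, ∀ f : E → ℂ, Differentiable ℂ f → ∃ P : PowerExpansion E,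
    (∀ j, ‖P.form j‖ ≤ C) ∧ P.Represents f ∧
      ∀ R M : ℝ≥0, 0 < R → (∀ v, ‖v‖ ≤ Λ * R → ‖f v‖ ≤ M) → P.majorant R ≤ B * M

theorem hasPowerExpansions_of_subsingleton [Subsingleton E] : HasPowerExpansions E := by
  refine ⟨0, 0, 1, fun f _ => ⟨⟨Unit, fun _ => f 0, fun _ => 0, fun _ => 0, inferInstance⟩, by simp,
    fun v => ?_, fun R M _ hM => ?_⟩⟩
  · simp only [Subsingleton.elim v 0, pow_zero, mul_one]
    exact hasSum_unique fun _ : Unit => f 0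
  · have hM0 : ‖f 0‖₊ ≤ M := hM 0 (by simp)
    simpa [majorant, enorm_eq_nnnorm] using hM0

theorem HasPowerExpansions.of_equiv (h : HasPowerExpansions E) (e : E' ≃L[ℂ] E) :
    HasPowerExpansions E' := by
  obtain ⟨C, Λ, B, h⟩ := h
  refine ⟨C * ‖(e : E' →L[ℂ] E)‖₊, ‖(e.symm : E →L[ℂ] E')‖₊ * Λ, B, fun f hf => ?_⟩
  obtain ⟨P, hC, hP, hB⟩ := h (f ∘ e.symm) (hf.comp e.symm.differentiable)
  refine ⟨P.comp e, fun j => ?_, fun v => ?_, fun R M hR hM => hB R M hR fun v hv => hM _ ?_⟩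
  · exact ((P.form j).opNorm_comp_le _).trans (mul_le_mul_of_nonneg_right (hC j) (norm_nonneg _))
  · simpa [PowerExpansion.comp] using hP (e v)
  · rw [NNReal.coe_mul, mul_assoc]
    exact (e.symm : E →L[ℂ] E').le_opNorm_of_le hv

theorem HasPowerExpansions.complex_prod [FiniteDimensional ℂ E]
    (h : HasPowerExpansions E) : HasPowerExpansions (ℂ × E) := by
  obtain ⟨C, Λ, B, h⟩ := h
  refine ⟨1 + C, Λ + 2, 2 * B, fun f hf => ?_⟩
  let g : ℕ → E → ℂ := fun k z => (k.factorial : ℂ)⁻¹ * iteratedDeriv k (fun w => f (w, z)) 0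
  have hg : ∀ k, Differentiable ℂ (g k) := fun k =>
    (differentiable_iteratedDeriv_slice hf k 0).const_mul _
  have hsum : ∀ p : ℂ × E, HasSum (fun k => p.1 ^ k * g k p.2) (f p) :=
    hasSum_pow_mul_iteratedDeriv_slice hf
  have hbound : ∀ z (r M : ℝ), 0 < r → (∀ w, ‖w‖ ≤ r → ‖f (w, z)‖ ≤ M) →
      ∀ k, ‖g k z‖ ≤ M / r ^ k := fun z _ _ => norm_inv_factorial_mul_iteratedDeriv_le
    (hf.comp (differentiable_id.prodMk (differentiable_const z)))
  clear_value g
  choose P hC hP hB using fun k : ℕ => h (g k) (hg k)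
  have hmaj : ∀ R M : ℝ≥0, 0 < R → (∀ v, ‖v‖ ≤ (Λ + 2 : ℝ≥0) * R → ‖f v‖ ≤ M) →
      (cons P).majorant R ≤ (2 * B : ℝ≥0) * M := fun R M hR hM => by
    refine majorant_cons_le_of_forall hR fun k => hB k R _ hR fun z hz => ?_
    have hw : ∀ w : ℂ, ‖w‖ ≤ 2 * R → ‖f (w, z)‖ ≤ M := fun w hw => hM (w, z) <| by
      push_cast
      exact max_le (hw.trans (by gcongr; simp)) (hz.trans (by gcongr; simp))
    push_cast
    exact hbound z _ _ (by positivity) hw k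
  have hfin : ∀ R, (cons P).majorant R ≠ ∞ := majorant_ne_top_of_forall_pos _ fun R hR => by
    obtain ⟨M, hM⟩ := exists_norm_le_of_norm_le hf.continuous ((Λ + 2 : ℝ≥0) * R)
    exact ne_top_of_le_ne_top (by finiteness) (hmaj R M hR hM)
  exact ⟨cons P, norm_form_cons_le hC, represents_cons hsum hP hC hfin, hmaj⟩

theorem hasPowerExpansions_of_finiteDimensional [FiniteDimensional ℂ E] :
    HasPowerExpansions E := by
  have hpi : ∀ n, HasPowerExpansions (Fin n → ℂ) := by
    intro n
    induction n with
    | zero => exact hasPowerExpansions_of_subsingleton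
    | succ n ih => exact ih.complex_prod.of_equiv (Fin.consEquivL ℂ fun _ => ℂ).symm
  exact (hpi _).of_equiv (Module.finBasis ℂ E).equivFunL

theorem PowerExpansion.exists_represents [FiniteDimensional ℂ E] {f : E → ℂ}
    (hf : Differentiable ℂ f) :
    ∃ P : PowerExpansion E, P.Represents f ∧ (∃ C : ℝ, ∀ j, ‖P.form j‖ ≤ C) ∧
      ∀ R, P.majorant R ≠ ∞ := by
  obtain ⟨C, Λ, B, h⟩ := hasPowerExpansions_of_finiteDimensional (E := E)
  obtain ⟨P, hC, hP, hB⟩ := h f hf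
  refine ⟨P, hP, ⟨C, hC⟩, P.majorant_ne_top_of_forall_pos fun R hR => ?_⟩
  obtain ⟨M, hM⟩ := exists_norm_le_of_norm_le hf.continuous (Λ * R)
  exact ne_top_of_le_ne_top (by finiteness) (hB R M hR hM)

end PowerExpansions

section SquareRootDescent

open Metric
open scoped NNReal ENNReal

theorem cpow_half_sq (z : ℂ) : (z ^ (1 / 2 : ℂ)) ^ 2 = z := by
  simp

theorem exists_sqrt_branch (l ζ₀ : ℂ) : ∃ b : ℂ → ℂ, (∀ ζ, b ζ ^ 2 = ζ + l) ∧
    ContinuousAt b ζ₀ ∧ (ζ₀ + l ≠ 0 → DifferentiableAt ℂ b ζ₀) := by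
  by_cases h : ζ₀ + l = 0
  · refine ⟨fun ζ => (ζ + l) ^ (1 / 2 : ℂ), fun ζ => cpow_half_sq _, ?_, fun h' => absurd h h'⟩
    refine ContinuousAt.comp (f := (· + l)) (g := (· ^ (1 / 2 : ℂ))) ?_ (by fun_prop)
    rw [h]
    exact Complex.continuousAt_cpow_const_of_re_pos (.inl le_rfl) (by norm_num)
  · have hd : DifferentiableAt ℂ (fun ζ => (ζ₀ + l) ^ (1 / 2 : ℂ) *
        ((ζ + l) / (ζ₀ + l)) ^ (1 / 2 : ℂ)) ζ₀ := by
      refine (DifferentiableAt.cpow (by fun_prop) (by fun_prop) ?_).const_mul _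
      rw [div_self h]
      exact Complex.one_mem_slitPlane
    refine ⟨_, fun ζ => ?_, hd.continuousAt, fun _ => hd⟩
    rw [mul_pow, cpow_half_sq, cpow_half_sq, mul_div_cancel₀ _ h]

section Even

theorem exists_sqrt_branch_pi {ι : Type*} [Finite ι] (t : ι → ℂ) (ζ₀ : ℂ) :
    ∃ b : ℂ → ι → ℂ, (∀ ζ i, b ζ i ^ 2 = ζ + t i) ∧ ContinuousAt b ζ₀ ∧
      ((∀ i, ζ₀ + t i ≠ 0) → DifferentiableAt ℂ b ζ₀) := by
  choose b hsq hcont hd using fun i => exists_sqrt_branch (t i) ζ₀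
  exact ⟨fun ζ i => b i ζ, fun ζ i => hsq i ζ, continuousAt_pi.2 hcont,
    fun hne => differentiableAt_pi.2 fun i => hd i (hne i)⟩

variable {ι : Type*} [Finite ι] {g : (ι → ℂ) → ℂ}

theorem continuous_comp_sqrt (hg : Continuous g)
    (heven : ∀ y y' : ι → ℂ, y ^ 2 = y' ^ 2 → g y = g y') (t : ι → ℂ) :
    Continuous fun ζ : ℂ => g fun i => (ζ + t i) ^ (1 / 2 : ℂ) := by
  refine continuous_iff_continuousAt.2 fun ζ₀ => ?_
  obtain ⟨b, hsq, hcont, -⟩ := exists_sqrt_branch_pi t ζ₀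
  rw [funext fun ζ => heven _ (b ζ) (funext fun i => (cpow_half_sq _).trans (hsq ζ i).symm)]
  exact hg.continuousAt.comp hcont

theorem differentiableAt_comp_sqrt (hg : Differentiable ℂ g)
    (heven : ∀ y y' : ι → ℂ, y ^ 2 = y' ^ 2 → g y = g y') {t : ι → ℂ} {ζ₀ : ℂ}
    (hζ₀ : ∀ i, ζ₀ + t i ≠ 0) :
    DifferentiableAt ℂ (fun ζ : ℂ => g fun i => (ζ + t i) ^ (1 / 2 : ℂ)) ζ₀ := by
  have := Fintype.ofFinite ι
  obtain ⟨b, hsq, -, hd⟩ := exists_sqrt_branch_pi t ζ₀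
  rw [funext fun ζ => heven _ (b ζ) (funext fun i => (cpow_half_sq _).trans (hsq ζ i).symm)]
  exact (hg _).comp ζ₀ (hd hζ₀)

theorem circleAverage_comp_sqrt (hg : Differentiable ℂ g)
    (heven : ∀ y y' : ι → ℂ, y ^ 2 = y' ^ 2 → g y = g y') (y : ι → ℂ) (ρ : ℝ) :
    Real.circleAverage (fun w => g fun i => (w ^ 2 + y i ^ 2) ^ (1 / 2 : ℂ)) 0 ρ = g y := by
  have hcont := continuous_comp_sqrt hg.continuous heven (y ^ 2)
  refine (circleAverage_of_differentiable_on_off_countable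
    (s := Set.range (fun i => Complex.I * y i) ∪ Set.range (fun i => -(Complex.I * y i)))
    ((Set.countable_range _).union (Set.countable_range _))
    (hcont.comp (continuous_pow 2)).continuousOn ?_).trans ?_
  rotate_left
  · exact heven _ _ (funext fun i => by simp)
  · intro w hw
    have hne : ∀ i, w ^ 2 + y i ^ 2 ≠ 0 := fun i hi => hw.2 <| by
      have hsq : w ^ 2 = (Complex.I * y i) ^ 2 := by
        rw [mul_pow, Complex.I_sq]
        linear_combination hi
      exact (sq_eq_sq_iff_eq_or_eq_neg.1 hsq).imp (fun h => ⟨i, h.symm⟩) fun h => ⟨i, h.symm⟩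
    exact (differentiableAt_comp_sqrt hg heven hne).comp w (by fun_prop)

end Even

variable {𝔸 : Type*} [NormedRing 𝔸] [NormedAlgebra ℂ 𝔸]

theorem radius_ofScalars_le (c : ℕ → ℂ) : (FormalMultilinearSeries.ofScalars ℂ c).radius ≤
    (FormalMultilinearSeries.ofScalars 𝔸 c).radius := by
  refine ENNReal.le_of_forall_nnreal_lt fun r hr => ?_
  obtain ⟨C, -, hC⟩ := FormalMultilinearSeries.norm_mul_pow_le_of_lt_radius _ hr
  refine FormalMultilinearSeries.le_radius_of_eventually_le _ C ?_
  filter_upwards [Filter.eventually_gt_atTop 0] with n hn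
  refine (mul_le_mul_of_nonneg_right ?_ (by positivity)).trans (hC n)
  simpa using FormalMultilinearSeries.ofScalars_norm_le 𝔸 c n hn

/-- The binomial series of `√(1 + M)`, which converges for `‖M‖ < 1`. -/
noncomputable def sqrtOneAdd (M : 𝔸) : 𝔸 :=
  (binomialSeries 𝔸 (1 / 2 : ℂ)).sum M

theorem one_le_radius_binomialSeries (a : ℂ) : 1 ≤ (binomialSeries 𝔸 a).radius :=
  binomialSeries_radius_ge_one.trans (radius_ofScalars_le _)

theorem hasSum_binomialSeries_cpow {z : ℂ} (hz : ‖z‖ < 1) (a : ℂ) :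
    HasSum (fun k => Ring.choose a k * z ^ k) ((1 + z) ^ a) := by
  have h := Complex.one_add_cpow_hasFPowerSeriesOnBall_zero (a := a)
  have hz' : z ∈ eball (0 : ℂ) 1 := by simpa [← ofReal_norm, mem_eball, edist_zero_right] using hz
  simpa [binomialSeries, mul_comm] using h.hasSum hz'

theorem sqrtOneAdd_map {ι : Type*} [Finite ι] (Φ : (ι → ℂ) →ₐ[ℂ] 𝔸) {t : ι → ℂ}
    (ht : ∀ i, ‖t i‖ < 1) : sqrtOneAdd (Φ t) = Φ fun i => (1 + t i) ^ (1 / 2 : ℂ) := by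
  have hsum : HasSum (fun k => Ring.choose (1 / 2 : ℂ) k • t ^ k)
      (fun i => (1 + t i) ^ (1 / 2 : ℂ)) := Pi.hasSum.2 fun i => hasSum_binomialSeries_cpow (ht i) _
  have hmap := hsum.map Φ.toLinearMap Φ.toLinearMap.continuous_of_finiteDimensional
  refine HasSum.tsum_eq ?_
  convert! hmap using 2 with k
  simp [binomialSeries, FormalMultilinearSeries.ofScalars]

/-- For `|w|² > ‖M‖`, the square root of `w² + M` that is close to `w`. -/
noncomputable def sqrtSqAdd (w : ℂ) (M : 𝔸) : 𝔸 :=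
  w • sqrtOneAdd ((w ^ 2)⁻¹ • M)

theorem sqrtSqAdd_map {ι : Type*} [Finite ι] (Φ : (ι → ℂ) →ₐ[ℂ] 𝔸) {w : ℂ} {t : ι → ℂ}
    (ht : ∀ i, ‖t i‖ < ‖w‖ ^ 2) :
    ∃ s : ι → ℂ, (∀ i, s i ^ 2 = w ^ 2 + t i) ∧ sqrtSqAdd w (Φ t) = Φ s := by
  refine ⟨w • fun i => (1 + ((w ^ 2)⁻¹ • t) i) ^ (1 / 2 : ℂ), fun i => ?_, ?_⟩
  · have hw : w ≠ 0 := by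
      rintro rfl
      simpa using (norm_nonneg _).trans_lt (ht i)
    rw [Pi.smul_apply, smul_eq_mul, mul_pow, cpow_half_sq, Pi.smul_apply, smul_eq_mul]
    field_simp
  · rw [sqrtSqAdd, ← map_smul, sqrtOneAdd_map, map_smul]
    intro i
    have hw : 0 < ‖w‖ ^ 2 := (norm_nonneg _).trans_lt (ht i)
    rw [Pi.smul_apply, norm_smul, norm_inv, norm_pow, inv_mul_lt_iff₀ hw, mul_one]
    exact ht i

variable [CompleteSpace 𝔸]

theorem differentiableOn_sqrtOneAdd : DifferentiableOn ℂ (sqrtOneAdd (𝔸 := 𝔸)) (ball 0 1) := by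
  have hr := one_le_radius_binomialSeries (𝔸 := 𝔸) (1 / 2)
  have h := ((binomialSeries 𝔸 (1 / 2 : ℂ)).hasFPowerSeriesOnBall
    (one_pos.trans_le hr)).differentiableOn
  refine h.mono fun M hM => eball_subset_eball hr ?_
  simpa [← ofReal_norm, mem_eball, edist_zero_right] using hM

theorem differentiableAt_sqrtSqAdd {w : ℂ} {M : 𝔸} (hM : ‖M‖ < ‖w‖ ^ 2) :
    DifferentiableAt ℂ (fun p : ℂ × 𝔸 => sqrtSqAdd p.1 p.2) (w, M) := by
  have hw : 0 < ‖w‖ ^ 2 := (norm_nonneg M).trans_lt hM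
  have hw0 : w ^ 2 ≠ 0 := norm_pos_iff.1 (by rwa [norm_pow])
  have hmem : (w ^ 2)⁻¹ • M ∈ ball (0 : 𝔸) 1 := by
    rw [mem_ball_zero_iff, norm_smul, norm_inv, norm_pow, inv_mul_lt_iff₀ hw, mul_one]
    exact hM
  have hsmul : DifferentiableAt ℂ (fun p : ℂ × 𝔸 => (p.1 ^ 2)⁻¹ • p.2) (w, M) := by
    fun_prop (disch := assumption)
  exact differentiableAt_fst.smul (DifferentiableAt.comp (w, M)
    (differentiableOn_sqrtOneAdd.differentiableAt (isOpen_ball.mem_nhds hmem)) hsmul)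

/-- The average of `h` over the square roots of `w² + M` for `|w| = ‖M‖ + 1`. If `h A` only depends
on `A²`, then `w² ↦ h (√(w² + M))` is an entire function of `w²`, so the average is its value
`h (√M)` at `0`; but it makes sense, and is holomorphic in `M`, for all `M`. -/
noncomputable def sqrtDescent (h : 𝔸 → ℂ) (M : 𝔸) : ℂ :=
  Real.circleAverage (fun w => h (sqrtSqAdd w M)) 0 (‖M‖ + 1)

theorem lt_sq_of_add_one_le {x ρ : ℝ} (hx : 0 ≤ x) (hρ : x + 1 ≤ ρ) : x < ρ ^ 2 := by
  nlinarith

theorem sqrtDescent_eq_circleAverage {h : 𝔸 → ℂ} (hh : Differentiable ℂ h) {M : 𝔸} {ρ : ℝ}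
    (hρ : ‖M‖ + 1 ≤ ρ) :
    sqrtDescent h M = Real.circleAverage (fun w => h (sqrtSqAdd w M)) 0 ρ := by
  have hpos : 0 < ‖M‖ + 1 := by positivity
  have hd : ∀ w : ℂ, ‖M‖ + 1 ≤ ‖w‖ → DifferentiableAt ℂ (fun w => h (sqrtSqAdd w M)) w :=
    fun w hw => (hh _).comp w (DifferentiableAt.comp (f := fun w => (w, M)) w
      (differentiableAt_sqrtSqAdd (lt_sq_of_add_one_le (norm_nonneg M) hw)) (by fun_prop))
  rw [sqrtDescent, Real.circleAverage_eq_circleIntegral hpos.ne',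
    Real.circleAverage_eq_circleIntegral (hpos.trans_le hρ).ne']
  congr 1
  refine (Complex.circleIntegral_sub_center_inv_smul_eq_of_differentiable_on_annulus_off_countable
    hpos hρ Set.countable_empty (fun w hw => ?_) fun w hw => ?_).symm
  · exact (hd w (by simpa using hw.2)).continuousAt.continuousWithinAt
  · exact hd w (le_of_lt (by simpa using hw.1.2))

theorem sqrtDescent_map_sq {h : 𝔸 → ℂ} (hh : Differentiable ℂ h) {ι : Type*} [Finite ι]
    (Φ : (ι → ℂ) →ₐ[ℂ] 𝔸) (heven : ∀ y y' : ι → ℂ, y ^ 2 = y' ^ 2 → h (Φ y) = h (Φ y'))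
    (y : ι → ℂ) : sqrtDescent h (Φ (y ^ 2)) = h (Φ y) := by
  have hΦ : Differentiable ℂ Φ :=
    (LinearMap.toContinuousLinearMap Φ.toLinearMap).differentiable
  have := Fintype.ofFinite ι
  set ρ := ‖Φ (y ^ 2)‖ + ‖y ^ 2‖ + 1
  have hy : ∀ i, ‖(y ^ 2) i‖ < |ρ| ^ 2 := fun i => by
    refine (norm_le_pi_norm (y ^ 2) i).trans_lt (lt_sq_of_add_one_le (norm_nonneg _) ?_)
    rw [abs_of_nonneg (by positivity)]
    linarith [norm_nonneg (Φ (y ^ 2))]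
  rw [sqrtDescent_eq_circleAverage hh (by linarith [norm_nonneg (y ^ 2)] : _ ≤ ρ)]
  refine Eq.trans ?_ (circleAverage_comp_sqrt (g := fun y => h (Φ y)) (hh.comp hΦ) heven y ρ)
  refine Real.circleAverage_congr_sphere fun w hw => ?_
  rw [← mem_sphere_zero_iff_norm.1 hw] at hy
  obtain ⟨s, hs, hw⟩ := sqrtSqAdd_map Φ hy
  simp only [hw]
  exact heven _ _ (funext fun i => (hs i).trans (cpow_half_sq _).symm)

theorem differentiableAt_sqrtSqAdd_of_sphere {w : ℂ} {M : 𝔸} {R : ℝ} (hw : w ∈ sphere 0 |R + 1|)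
    (hM : ‖M‖ ≤ R) : DifferentiableAt ℂ (fun p : ℂ × 𝔸 => sqrtSqAdd p.1 p.2) (w, M) := by
  have hR : 0 ≤ R := (norm_nonneg M).trans hM
  rw [mem_sphere_zero_iff_norm, abs_of_nonneg (by positivity)] at hw
  exact differentiableAt_sqrtSqAdd (by rw [hw]; nlinarith)

theorem differentiable_sqrtDescent [FiniteDimensional ℂ 𝔸] {h : 𝔸 → ℂ}
    (hh : Differentiable ℂ h) : Differentiable ℂ (sqrtDescent h) := by
  intro M₀
  set R := ‖M₀‖ + 1
  have hball : ∀ M ∈ ball (0 : 𝔸) R, ‖M‖ ≤ R := fun M hM => (mem_ball_zero_iff.1 hM).le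
  have hd : ∀ M ∈ ball (0 : 𝔸) R, ∀ w ∈ sphere (0 : ℂ) |R + 1|,
      DifferentiableAt ℂ (fun p : ℂ × 𝔸 => h (sqrtSqAdd p.1 p.2)) (w, M) := fun M hM w hw =>
    (hh _).comp _ (differentiableAt_sqrtSqAdd_of_sphere hw (hball M hM))
  have havg : DifferentiableOn ℂ
      (fun M => Real.circleAverage (fun w => h (sqrtSqAdd w M)) 0 (R + 1)) (ball 0 R) := by
    refine differentiableOn_circleAverage isOpen_ball (fun p hp => ?_) fun w hw M hM => ?_
    · exact (ContinuousAt.comp (f := Prod.swap) (hd p.1 hp.1 p.2 hp.2).continuousAt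
        continuous_swap.continuousAt).continuousWithinAt
    · exact (DifferentiableAt.comp M (hd M hM w hw)
        (by fun_prop : DifferentiableAt ℂ (fun M => (w, M)) M)).differentiableWithinAt
  have hM₀ : ball (0 : 𝔸) R ∈ 𝓝 M₀ :=
    isOpen_ball.mem_nhds (mem_ball_zero_iff.2 (lt_add_one _))
  refine (havg.differentiableAt hM₀).congr_of_eventuallyEq ?_
  filter_upwards [hM₀] with M hM
  exact sqrtDescent_eq_circleAverage hh (by linarith [hball M hM])

theorem norm_circleAverage_le {F : Type*} [NormedAddCommGroup F] [NormedSpace ℝ F] {f : ℂ → F}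
    {c : ℂ} {ρ C : ℝ} (hf : ∀ w ∈ sphere c |ρ|, ‖f w‖ ≤ C) : ‖Real.circleAverage f c ρ‖ ≤ C := by
  have h := intervalIntegral.norm_integral_le_of_norm_le_const (a := 0) (b := 2 * Real.pi)
    fun t _ => hf _ (circleMap_mem_sphere' c ρ t)
  rw [sub_zero, abs_of_pos Real.two_pi_pos] at h
  rw [Real.circleAverage_def, norm_smul, norm_inv, Real.norm_of_nonneg Real.two_pi_pos.le,
    inv_mul_le_iff₀ Real.two_pi_pos]
  linarith

theorem exists_forall_norm_sqrtDescent_le [FiniteDimensional ℂ 𝔸] (R : ℝ) :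
    ∃ S : ℝ, ∀ h : 𝔸 → ℂ, Differentiable ℂ h → ∀ C, (∀ A, ‖A‖ ≤ S → ‖h A‖ ≤ C) →
      ∀ M, ‖M‖ ≤ R → ‖sqrtDescent h M‖ ≤ C := by
  have : ProperSpace 𝔸 := FiniteDimensional.proper ℂ 𝔸
  have hcont : ContinuousOn (fun p : ℂ × 𝔸 => sqrtSqAdd p.1 p.2)
      (sphere 0 |R + 1| ×ˢ closedBall 0 R) := fun p hp =>
    (differentiableAt_sqrtSqAdd_of_sphere hp.1
      (mem_closedBall_zero_iff.1 hp.2)).continuousAt.continuousWithinAt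
  obtain ⟨S, hS⟩ := ((isCompact_sphere (0 : ℂ) |R + 1|).prod
    (isCompact_closedBall (0 : 𝔸) R)).exists_bound_of_continuousOn hcont
  refine ⟨S, fun h hh C hC M hM => ?_⟩
  rw [sqrtDescent_eq_circleAverage hh (by linarith : ‖M‖ + 1 ≤ R + 1)]
  exact norm_circleAverage_le fun w hw => hC _ (hS (w, M) ⟨hw, mem_closedBall_zero_iff.2 hM⟩)

end SquareRootDescent

section RealForm

open Polynomial

theorem finite_spectrum_of_finiteDimensional {𝕜 𝔸 : Type*} [Field 𝕜] [Ring 𝔸] [Algebra 𝕜 𝔸]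
    [FiniteDimensional 𝕜 𝔸] (a : 𝔸) : (spectrum 𝕜 a).Finite := by
  rcases subsingleton_or_nontrivial 𝔸 with h | h
  · simp
  refine ((minpoly 𝕜 a).rootSet_finite 𝕜).subset fun x hx => ?_
  have hx' := spectrum.subset_polynomial_aeval a (minpoly 𝕜 a) ⟨x, hx, rfl⟩
  rw [minpoly.aeval, spectrum.zero_eq, Set.mem_singleton_iff] at hx'
  exact (mem_rootSet_of_ne (minpoly.ne_zero (Algebra.IsIntegral.isIntegral a))).2
    (by simpa using hx')

variable {𝔸 : Type*} [CStarAlgebra 𝔸]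

theorem exists_starAlgHom_pi_eq [FiniteDimensional ℂ 𝔸] {M : 𝔸} (hM : IsSelfAdjoint M) :
    ∃ (ι : Type) (_ : Finite ι) (Φ : (ι → ℂ) →⋆ₐ[ℂ] 𝔸) (l : ι → ℝ), Function.Injective l ∧
      (∀ i, l i ∈ spectrum ℝ M) ∧ Φ (fun i => (l i : ℂ)) = M := by
  have : Finite (spectrum ℂ M) := finite_spectrum_of_finiteDimensional M
  let toContinuousMap : (spectrum ℂ M → ℂ) →⋆ₐ[ℂ] C(spectrum ℂ M, ℂ) :=
    { toFun y := ⟨y, continuous_of_discreteTopology⟩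
      map_one' := rfl
      map_mul' _ _ := rfl
      map_zero' := rfl
      map_add' _ _ := rfl
      commutes' _ := rfl
      map_star' _ := rfl }
  have hre : ∀ i : spectrum ℂ M, ((i : ℂ).re : ℂ) = i := fun i => (hM.mem_spectrum_eq_re i.2).symm
  refine ⟨spectrum ℂ M, this, (cfcHom hM.isStarNormal).comp toContinuousMap,
    fun i => (i : ℂ).re, fun i j hij => Subtype.ext ?_, fun i => ?_, ?_⟩
  · rw [← hre i, ← hre j]
    exact congrArg _ hij
  · rw [← spectrum.algebraMap_mem_iff ℂ]
    exact (congrArg (· ∈ spectrum ℂ M) (hre i)).mpr i.2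
  · rw [funext hre]
    exact cfcHom_id hM.isStarNormal

theorem exists_aeval_starAlgHom_eq {𝔸 ι : Type*} [Ring 𝔸] [StarRing 𝔸] [Algebra ℂ 𝔸] [Finite ι]
    {Φ : (ι → ℂ) →⋆ₐ[ℂ] 𝔸} {l : ι → ℝ} (hl : Function.Injective l) (y : ι → ℝ) :
    ∃ p : ℝ[X], aeval (Φ fun i => (l i : ℂ)) p = Φ fun i => (y i : ℂ) := by
  classical
  have := Fintype.ofFinite ι
  have hp : aeval (fun i => (l i : ℂ)) (Lagrange.interpolate Finset.univ l y) =
      fun i => (y i : ℂ) := funext fun i => by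
    have hi : (Lagrange.interpolate Finset.univ l y).eval (l i) = y i :=
      Lagrange.eval_interpolate_at_node y hl.injOn (Finset.mem_univ i)
    rw [aeval_pi_apply₂, ← hi]
    exact aeval_algebraMap_apply_eq_algebraMap_eval _ _
  refine ⟨Lagrange.interpolate Finset.univ l y, ?_⟩
  rw [← hp]
  exact aeval_algHom_apply (Φ.toAlgHom.restrictScalars ℝ) _ _

theorem pos_of_mem_spectrum_star_mul_self {a : 𝔸} (ha : IsUnit a) {x : ℝ}
    (hx : x ∈ spectrum ℝ (star a * a)) : 0 < x :=
  (spectrum_star_mul_self_nonneg _ hx).lt_of_ne'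
    fun h0 => spectrum.zero_notMem ℝ (ha.star.mul ha) (h0 ▸ hx)

/-- A complex-linear anti-automorphism of order two that commutes with the adjoint, such as the
transposition of complex matrices or `A ↦ β⁻¹ Aᵗ β` for a unitary `β` with `βᵗ = ±β`. -/
structure StarAntiInvolution (𝔸 : Type*) [Ring 𝔸] [StarRing 𝔸] [Algebra ℂ 𝔸] extends
    𝔸 →ₗ[ℂ] 𝔸 where
  map_mul' : ∀ a b, toFun (a * b) = toFun b * toFun a
  map_star' : ∀ a, toFun (star a) = star (toFun a)
  involutive' : Function.Involutive toFun

namespace StarAntiInvolution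

section Algebraic

variable {𝔸 : Type*} [Ring 𝔸] [StarRing 𝔸] [Algebra ℂ 𝔸]

instance : CoeFun (StarAntiInvolution 𝔸) fun _ => 𝔸 → 𝔸 := ⟨fun θ => θ.toLinearMap⟩

variable (θ : StarAntiInvolution 𝔸)

protected theorem map_mul (a b : 𝔸) : θ (a * b) = θ b * θ a := θ.map_mul' a b

protected theorem map_star (a : 𝔸) : θ (star a) = star (θ a) := θ.map_star' a

theorem apply_apply (a : 𝔸) : θ (θ a) = a := θ.involutive' a

protected theorem map_one : θ 1 = 1 := by
  simpa [θ.apply_apply] using (θ.map_mul (θ 1) 1).symm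

variable [StarModule ℂ 𝔸]

/-- The elements on which the anti-involution is the adjoint: a real `*`-algebra `R` with
`𝔸 = R ⊕ i R`. -/
def realForm : Subalgebra ℝ 𝔸 where
  carrier := {a | θ a = star a}
  mul_mem' {a b} (ha : θ a = star a) (hb : θ b = star b) := by
    simp only [Set.mem_ofPred_eq, θ.map_mul, star_mul, ha, hb]
  add_mem' {a b} (ha : θ a = star a) (hb : θ b = star b) := by
    simp only [Set.mem_ofPred_eq, map_add, star_add, ha, hb]
  algebraMap_mem' r := by
    rw [Set.mem_ofPred_eq, Algebra.algebraMap_eq_smul_one, ← Complex.coe_smul, map_smul,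
      θ.map_one, star_smul, star_one, Complex.star_def, Complex.conj_ofReal]

variable {θ}

theorem mem_realForm {a : 𝔸} : a ∈ θ.realForm ↔ θ a = star a := Iff.rfl

theorem star_mem_realForm {a : 𝔸} (ha : a ∈ θ.realForm) : star a ∈ θ.realForm := by
  rw [mem_realForm, θ.map_star, mem_realForm.1 ha]

theorem exists_eq_add_I_smul (θ : StarAntiInvolution 𝔸) (A : 𝔸) :
    ∃ a ∈ θ.realForm, ∃ b ∈ θ.realForm, A = a + Complex.I • b := by
  refine ⟨(1 / 2 : ℂ) • (A + star (θ A)), ?_, (-Complex.I / 2) • (A - star (θ A)), ?_, ?_⟩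
  · simp [mem_realForm, map_smul, map_add, θ.map_star, θ.apply_apply, add_comm]
  · simp only [mem_realForm, map_smul, map_sub, θ.map_star, θ.apply_apply, star_smul, star_sub,
      star_star, star_div₀, star_neg, Complex.star_def, Complex.conj_I, star_ofNat]
    module
  · have hI : Complex.I * (-Complex.I / 2) = 1 / 2 := by
      linear_combination (-1 / 2) * Complex.I_sq
    rw [smul_smul, hI]
    module

/-- The unitary elements of the real form. -/
def realUnitary (θ : StarAntiInvolution 𝔸) : Subgroup (unitary 𝔸) where
  carrier := {u | (u : 𝔸) ∈ θ.realForm}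
  one_mem' := one_mem θ.realForm
  mul_mem' ha hb := θ.realForm.mul_mem ha hb
  inv_mem' := star_mem_realForm

end Algebraic

section Spectral

variable {𝔸 : Type*} [Ring 𝔸] [StarRing 𝔸] [Algebra ℂ 𝔸] [StarModule ℂ 𝔸]
  {θ : StarAntiInvolution 𝔸} {ι : Type*} [Finite ι] {Φ : (ι → ℂ) →⋆ₐ[ℂ] 𝔸} {l : ι → ℝ}

theorem starAlgHom_ofReal_mem_realForm (hl : Function.Injective l)
    (hΦ : Φ (fun i => (l i : ℂ)) ∈ θ.realForm) (y : ι → ℝ) :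
    Φ (fun i => (y i : ℂ)) ∈ θ.realForm := by
  obtain ⟨p, hp⟩ := exists_aeval_starAlgHom_eq (Φ := Φ) hl y
  rw [← hp, aeval_eq_sum_range]
  exact sum_mem fun n _ => θ.realForm.smul_mem (pow_mem hΦ n) _

/-- The coordinatewise signs relating `y` and `y'` give a unitary element of the real form. -/
theorem apply_starAlgHom_eq_of_sq_eq {X : Type*} {h : 𝔸 → X}
    (hinv : ∀ u ∈ θ.realUnitary, ∀ A, h (u * A) = h A) (hl : Function.Injective l)
    (hΦ : Φ (fun i => (l i : ℂ)) ∈ θ.realForm) {y y' : ι → ℂ} (hy : y ^ 2 = y' ^ 2) :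
    h (Φ y) = h (Φ y') := by
  have hsign : ∀ i, ∃ s : ℝ, s * s = 1 ∧ y i = s * y' i := fun i => by
    rcases sq_eq_sq_iff_eq_or_eq_neg.1 (congrFun hy i) with h | h
    · exact ⟨1, by simp, by simp [h]⟩
    · exact ⟨-1, by simp, by simp [h]⟩
  choose s hs hys using hsign
  set σ : ι → ℂ := fun i => (s i : ℂ)
  have hσ : σ * σ = 1 := funext fun i => by
    rw [Pi.mul_apply, ← Complex.ofReal_mul, hs, Complex.ofReal_one, Pi.one_apply]
  have hstar : star σ = σ := funext fun i => Complex.conj_ofReal _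
  have hu : Φ σ ∈ unitary 𝔸 := by
    rw [Unitary.mem_iff, ← map_star, hstar, ← map_mul, hσ, map_one, and_self]
  have hfix := hinv ⟨Φ σ, hu⟩ (starAlgHom_ofReal_mem_realForm hl hΦ s) (Φ y')
  rwa [← map_mul, (funext hys : y = σ * y').symm] at hfix

end Spectral

variable {𝔸 : Type*} [CStarAlgebra 𝔸] {θ : StarAntiInvolution 𝔸}

theorem eq_zero_of_eq_zero_on_realForm {ψ : 𝔸 → ℂ} (hψ : Differentiable ℂ ψ)
    (h0 : ∀ a ∈ θ.realForm, ψ a = 0) (A : 𝔸) : ψ A = 0 := by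
  obtain ⟨a, ha, b, hb, rfl⟩ := exists_eq_add_I_smul θ A
  have hline : Differentiable ℂ fun t : ℂ => ψ (a + t • b) := by fun_prop
  have han : AnalyticOnNhd ℂ _ Set.univ := hline.differentiableOn.analyticOnNhd isOpen_univ
  refine congrFun (han.eq_of_frequently_eq (g := 0) (z₀ := 0) analyticOnNhd_const ?_) Complex.I
  have hreal : Filter.Tendsto ((↑) : ℝ → ℂ) (𝓝[≠] 0) (𝓝[≠] 0) :=
    Complex.continuous_ofReal.continuousWithinAt.tendsto_nhdsWithin fun t ht => by simpa using ht
  exact hreal.frequently (Filter.Frequently.of_forall fun t => h0 _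
    (θ.realForm.add_mem ha (θ.realForm.smul_mem hb t)))

variable [FiniteDimensional ℂ 𝔸]

/-- The polar part `u = a (a⋆ a)^{-1/2}` lies in the real form, so `h a = h (u⁻¹ a)` and
`u⁻¹ a = (a⋆ a)^{1/2}`. -/
theorem sqrtDescent_star_mul_self_of_isUnit {h : 𝔸 → ℂ} (hh : Differentiable ℂ h)
    (hinv : ∀ u ∈ θ.realUnitary, ∀ A, h (u * A) = h A) {a : 𝔸} (ha : a ∈ θ.realForm)
    (hunit : IsUnit a) : sqrtDescent h (star a * a) = h a := by
  have hM : star a * a ∈ θ.realForm := θ.realForm.mul_mem (star_mem_realForm ha) ha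
  obtain ⟨ι, _, Φ, l, hl, hspec, hΦ⟩ := exists_starAlgHom_pi_eq (IsSelfAdjoint.star_mul_self a)
  rw [← hΦ] at hM
  have hpos i : 0 < l i := pos_of_mem_spectrum_star_mul_self hunit (hspec i)
  set q : ι → ℂ := fun i => (√(l i) : ℂ) with hq
  set q' : ι → ℂ := fun i => ((√(l i))⁻¹ : ℝ) with hq'
  have hq'q : q' * q = 1 := funext fun i => by
    simp [hq, hq', (Real.sqrt_pos.2 (hpos i)).ne']
  have hsq : Φ (q ^ 2) = star a * a := by
    rw [← hΦ]
    congr 1 with i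
    rw [Pi.pow_apply, ← Complex.ofReal_pow, Real.sq_sqrt (hpos i).le]
  have hu : a * Φ q' ∈ unitary 𝔸 := by
    have hstar : star q' = q' := funext fun i => Complex.conj_ofReal _
    have hunit' : IsUnit (Φ q') := (IsUnit.of_mul_eq_one q hq'q).map Φ
    have hq'qq' : q' * (q ^ 2 * q') = 1 := by linear_combination (q' * q + 1) * hq'q
    rw [(hunit.mul hunit').mem_unitary_iff_star_mul_self, star_mul, ← map_star, hstar, mul_assoc,
      ← mul_assoc (star a), ← hsq, ← map_mul, ← map_mul, hq'qq', map_one]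
  have hfix := hinv ⟨a * Φ q', hu⟩
    (θ.realForm.mul_mem ha (starAlgHom_ofReal_mem_realForm hl hM _)) (Φ q)
  rw [mul_assoc, ← map_mul, hq'q, map_one, mul_one] at hfix
  rw [← hsq, hfix]
  exact sqrtDescent_map_sq hh Φ.toAlgHom (fun y y' => apply_starAlgHom_eq_of_sq_eq hinv hl hM) q

theorem sqrtDescent_star_mul_self {h : 𝔸 → ℂ} (hh : Differentiable ℂ h)
    (hinv : ∀ u ∈ θ.realUnitary, ∀ A, h (u * A) = h A) {a : 𝔸} (ha : a ∈ θ.realForm) :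
    sqrtDescent h (star a * a) = h a := by
  set ψ : ℝ → ℂ := fun t => sqrtDescent h (star (a + (t : ℂ) • 1) * (a + (t : ℂ) • 1)) -
    h (a + (t : ℂ) • 1)
  have hcont : Continuous ψ := by
    have := (differentiable_sqrtDescent hh).continuous
    have := hh.continuous
    fun_prop
  have hψ : ∀ᶠ t : ℝ in 𝓝[≠] 0, ψ t = 0 := by
    have hfin : (spectrum ℝ (-a) \ {0}).Finite := (finite_spectrum_of_finiteDimensional _).sdiff
    filter_upwards [self_mem_nhdsWithin,
      nhdsWithin_le_nhds (hfin.isClosed.isOpen_compl.mem_nhds (by simp))] with t ht0 ht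
    have hunit : IsUnit (algebraMap ℝ 𝔸 t - -a) := not_not.1 fun h => ht ⟨h, ht0⟩
    refine sub_eq_zero.2 (sqrtDescent_star_mul_self_of_isUnit hh hinv
      (θ.realForm.add_mem ha (θ.realForm.smul_mem θ.realForm.one_mem t)) ?_)
    rwa [sub_neg_eq_add, add_comm, Algebra.algebraMap_eq_smul_one, ← Complex.coe_smul] at hunit
  have h0 : ψ 0 = 0 := tendsto_nhds_unique (hcont.tendsto' 0 _ rfl |>.mono_left nhdsWithin_le_nhds)
    (tendsto_const_nhds.congr' (hψ.mono fun t ht => ht.symm))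
  simpa [ψ, sub_eq_zero] using h0

theorem sqrtDescent_apply_mul_self {h : 𝔸 → ℂ} (hh : Differentiable ℂ h)
    (hinv : ∀ u ∈ θ.realUnitary, ∀ A, h (u * A) = h A) (A : 𝔸) :
    sqrtDescent h (θ A * A) = h A := by
  have hθ : Differentiable ℂ θ := (LinearMap.toContinuousLinearMap θ.toLinearMap).differentiable
  refine sub_eq_zero.1 (eq_zero_of_eq_zero_on_realForm (θ := θ)
    (ψ := fun A => sqrtDescent h (θ A * A) - h A)
    (((differentiable_sqrtDescent hh).comp (hθ.mul differentiable_id)).sub hh) (fun a ha => ?_) A)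
  rw [mem_realForm.1 ha, sqrtDescent_star_mul_self hh hinv ha, sub_self]

end StarAntiInvolution

end RealForm

section GroupAverage

open MeasureTheory

variable {K E : Type*} [Group K] [MeasurableSpace K]

/-- The average of `g` over the orbits of `K`, with respect to a measure `μ` on `K`. -/
noncomputable def orbitAverage [SMul K E] (μ : Measure K) (g : E → ℂ) (x : E) : ℂ :=
  ∫ k, g (k⁻¹ • x) ∂μ

theorem norm_orbitAverage_le [SMul K E] {μ : Measure K} [IsProbabilityMeasure μ] {g : E → ℂ}
    {x : E} {C : ℝ} (hC : ∀ k : K, ‖g (k • x)‖ ≤ C) : ‖orbitAverage μ g x‖ ≤ C := by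
  simpa [orbitAverage] using norm_integral_le_of_norm_le_const (μ := μ) (.of_forall fun k => hC k⁻¹)

variable [TopologicalSpace K] [IsTopologicalGroup K] [BorelSpace K]

theorem orbitAverage_smul [MulAction K E] (μ : Measure K)
    [μ.IsMulLeftInvariant] (g : E → ℂ) (a : K) (x : E) :
    orbitAverage μ g (a • x) = orbitAverage μ g x := by
  simpa [orbitAverage, mul_smul] using
    integral_mul_left_eq_self (μ := μ) (fun k => g (k⁻¹ • x)) a⁻¹

variable [CompactSpace K] {μ : Measure K}

theorem hasSum_mul_orbitAverage [TopologicalSpace E] [MulAction K E] [ContinuousSMul K E]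
    [IsProbabilityMeasure μ] {J : Type*} [Countable J] {c : J → ℂ}
    {g : J → E → ℂ} (hg : ∀ j, Continuous (g j)) {x : J → E} {C : J → ℝ}
    (hC : ∀ j (k : K), ‖g j (k • x j)‖ ≤ C j) (hsum : Summable fun j => ‖c j‖ * C j) {s : ℂ}
    (hs : ∀ k : K, HasSum (fun j => c j * g j (k • x j)) s) :
    HasSum (fun j => c j * orbitAverage μ (g j) (x j)) s := by
  have hcont : ∀ j, Continuous fun k : K => c j * g j (k⁻¹ • x j) := fun j => by
    have := hg j
    fun_prop
  have hbound : ∀ j, ∫ k : K, ‖c j * g j (k⁻¹ • x j)‖ ∂μ ≤ ‖c j‖ * C j := fun j => by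
    have hle : ∀ k : K, ‖c j * g j (k⁻¹ • x j)‖ ≤ ‖c j‖ * C j := fun k =>
      (norm_mul_le _ _).trans (mul_le_mul_of_nonneg_left (hC j k⁻¹) (norm_nonneg _))
    simpa using integral_mono_of_nonneg (μ := μ) (.of_forall fun k => norm_nonneg _)
      (integrable_const _) (.of_forall hle)
  have h := hasSum_integral_of_summable_integral_norm (μ := μ)
    (F := fun j (k : K) => c j * g j (k⁻¹ • x j))
    (fun j => (hcont j).integrable_of_hasCompactSupport (.of_compactSpace _))
    (hsum.of_nonneg_of_le (fun j => integral_nonneg fun k => norm_nonneg _) hbound)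
  simp only [integral_const_mul, (hs _).tsum_eq, integral_const, probReal_univ, one_smul] at h
  exact h

theorem differentiable_orbitAverage [NormedAddCommGroup E] [NormedSpace ℂ E]
    [FiniteDimensional ℂ E] [DistribMulAction K E] [ContinuousSMul K E] [SMulCommClass ℂ K E]
    [IsFiniteMeasure μ] {g : E → ℂ} (hg : Differentiable ℂ g) :
    Differentiable ℂ (orbitAverage μ g) := by
  have := hg.continuous
  refine differentiable_integral_of_continuous (by fun_prop) fun k => ?_
  exact hg.comp (differentiable_id.const_smul k⁻¹)

end GroupAverage

section Factorization

open MeasureTheory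

namespace StarAntiInvolution

variable {𝔸 : Type*} [CStarAlgebra 𝔸] {θ : StarAntiInvolution 𝔸}

theorem norm_realUnitary_smul (u : θ.realUnitary) (A : 𝔸) : ‖u • A‖ = ‖A‖ :=
  CStarRing.norm_coe_unitary_mul (u : unitary 𝔸) A

theorem norm_apply_realUnitary_smul_pow_le (τ : 𝔸 →L[ℂ] ℂ) (d : ℕ) (u : θ.realUnitary) (A : 𝔸) :
    ‖τ (u • A) ^ d‖ ≤ (‖τ‖ * ‖A‖) ^ d := by
  rw [norm_pow, ← norm_realUnitary_smul u A]
  gcongr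
  exact τ.le_opNorm _

instance [FiniteDimensional ℂ 𝔸] : CompactSpace θ.realUnitary := by
  have : ProperSpace 𝔸 := FiniteDimensional.proper ℂ 𝔸
  have : FiniteDimensional ℝ 𝔸 := FiniteDimensional.complexToReal 𝔸
  have hreal : IsClosed (θ.realForm : Set 𝔸) :=
    Submodule.closed_of_finiteDimensional (Subalgebra.toSubmodule θ.realForm)
  have hemb : IsClosedEmbedding fun u : θ.realUnitary => ((u : unitary 𝔸) : 𝔸) :=
    isClosed_unitary.isClosedEmbedding_subtypeVal.comp
      (hreal.preimage continuous_subtype_val).isClosedEmbedding_subtypeVal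
  have hbounded : ∀ u : θ.realUnitary, ((u : unitary 𝔸) : 𝔸) ∈ Metric.closedBall 0 ‖(1 : 𝔸)‖ :=
    fun u => mem_closedBall_zero_iff.2 (by simpa using (CStarRing.norm_coe_unitary_mul u.1 1).le)
  refine ⟨?_⟩
  convert hemb.isCompact_preimage (isCompact_closedBall (0 : 𝔸) ‖(1 : 𝔸)‖)
  exact (Set.eq_univ_of_forall hbounded).symm

instance : MeasurableSpace θ.realUnitary := borel _

instance : BorelSpace θ.realUnitary := ⟨rfl⟩

/-- The average over the unitary real form of the `d`-th power of a linear form. -/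
noncomputable def averagePow [FiniteDimensional ℂ 𝔸] (θ : StarAntiInvolution 𝔸) (τ : 𝔸 →L[ℂ] ℂ)
    (d : ℕ) : 𝔸 → ℂ :=
  orbitAverage (Measure.haarMeasure (⊤ : TopologicalSpace.PositiveCompacts θ.realUnitary))
    fun A => τ A ^ d

variable [FiniteDimensional ℂ 𝔸]

instance : IsProbabilityMeasure
    (Measure.haarMeasure (⊤ : TopologicalSpace.PositiveCompacts θ.realUnitary)) :=
  ⟨Measure.haarMeasure_self⟩

theorem norm_averagePow_le (τ : 𝔸 →L[ℂ] ℂ) (d : ℕ) (A : 𝔸) :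
    ‖θ.averagePow τ d A‖ ≤ (‖τ‖ * ‖A‖) ^ d :=
  norm_orbitAverage_le fun u => norm_apply_realUnitary_smul_pow_le τ d u A

theorem differentiable_averagePow (τ : 𝔸 →L[ℂ] ℂ) (d : ℕ) :
    Differentiable ℂ (θ.averagePow τ d) :=
  differentiable_orbitAverage (τ.differentiable.pow d)

theorem sqrtDescent_averagePow (τ : 𝔸 →L[ℂ] ℂ) (d : ℕ) (A : 𝔸) :
    sqrtDescent (θ.averagePow τ d) (θ A * A) = θ.averagePow τ d A :=
  sqrtDescent_apply_mul_self (differentiable_averagePow τ d)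
    (fun u hu A => orbitAverage_smul _ _ (⟨u, hu⟩ : θ.realUnitary) A) A

end StarAntiInvolution

/-- The data that make functions on `V` invariant under the unitary real form of `θ` factor through
`Q`: every linear form `ℓ` on `V` is lifted to an equivariant map `lift ℓ` into `𝔸`, whose Gram
element `θ (lift ℓ v) * lift ℓ v` is a holomorphic function `gram ℓ` of `Q v`. -/
structure GramLift {𝔸 V W : Type*} [CStarAlgebra 𝔸] [NormedAddCommGroup V] [NormedSpace ℂ V]
    [NormedAddCommGroup W] [NormedSpace ℂ W] (θ : StarAntiInvolution 𝔸) (Q : V → W) where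
  functional : 𝔸 →L[ℂ] ℂ
  lift : (V →L[ℂ] ℂ) → V → 𝔸
  act : θ.realUnitary → V → V
  gram : (V →L[ℂ] ℂ) → W → 𝔸
  functional_lift : ∀ ℓ v, functional (lift ℓ v) = ℓ v
  lift_act : ∀ ℓ u v, lift ℓ (act u v) = u • lift ℓ v
  gram_apply : ∀ ℓ v, gram ℓ (Q v) = θ (lift ℓ v) * lift ℓ v
  continuous_lift : ∀ v, Continuous fun ℓ => lift ℓ v
  continuous_gram : Continuous fun p : (V →L[ℂ] ℂ) × W => gram p.1 p.2
  differentiable_gram : ∀ ℓ, Differentiable ℂ (gram ℓ)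

namespace GramLift

open PowerExpansion
open scoped NNReal ENNReal

variable {𝔸 V W : Type*} [CStarAlgebra 𝔸] [NormedAddCommGroup V] [NormedSpace ℂ V]
  [NormedAddCommGroup W] [NormedSpace ℂ W] {θ : StarAntiInvolution 𝔸} {Q : V → W}
  [FiniteDimensional ℂ 𝔸] [FiniteDimensional ℂ V] (D : GramLift θ Q) (P : PowerExpansion V)

/-- The `j`-th term of the expansion of `f` averaged over the unitary real form, as a function
of `Q v`. -/
noncomputable def descentTerm (j : P.Index) (M : W) : ℂ :=
  P.coeff j * sqrtDescent (θ.averagePow D.functional (P.degree j)) (D.gram (P.form j) M)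

variable {D P} {C : ℝ}

theorem hasSum_descentTerm {f : V → ℂ} (hinv : ∀ u v, f (D.act u v) = f v) (hP : P.Represents f)
    (hC : ∀ j, ‖P.form j‖ ≤ C) (hmaj : ∀ R, P.majorant R ≠ ∞) (v : V) :
    HasSum (fun j => D.descentTerm P j (Q v)) (f v) := by
  obtain ⟨R, hR⟩ := exists_norm_le_of_norm_le (D.continuous_lift v) C
  have hbound : ∀ j (u : θ.realUnitary), ‖D.functional (u • D.lift (P.form j) v) ^ P.degree j‖ ≤
      ((‖D.functional‖₊ * R : ℝ≥0) : ℝ) ^ P.degree j := fun j u => by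
    refine (StarAntiInvolution.norm_apply_realUnitary_smul_pow_le ..).trans ?_
    push_cast
    gcongr
    exact hR _ (hC j)
  have hsum (u : θ.realUnitary) : HasSum
      (fun j => P.coeff j * D.functional (u • D.lift (P.form j) v) ^ P.degree j) (f v) := by
    simpa only [← D.lift_act, D.functional_lift, hinv] using hP (D.act u v)
  simp only [descentTerm, D.gram_apply, StarAntiInvolution.sqrtDescent_averagePow]
  exact hasSum_mul_orbitAverage (fun j => by fun_prop) hbound
    (summable_of_majorant_ne_top (hmaj _)) hsum

theorem differentiable_tsum_descentTerm [FiniteDimensional ℂ W] (hC : ∀ j, ‖P.form j‖ ≤ C)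
    (hmaj : ∀ R, P.majorant R ≠ ∞) : Differentiable ℂ fun M => ∑' j, D.descentTerm P j M := by
  intro M₀
  obtain ⟨R, hR⟩ := exists_norm_le_of_norm_le D.continuous_gram (max C (1 + ‖M₀‖))
  obtain ⟨S, hS⟩ := exists_forall_norm_sqrtDescent_le (𝔸 := 𝔸) R
  refine differentiableAt_tsum_of_dominated one_pos (fun j => ?_)
    (summable_of_majorant_ne_top (hmaj (‖D.functional‖₊ * S.toNNReal))) fun j M hM => ?_
  · exact (((differentiable_sqrtDescent (θ.differentiable_averagePow _ _)).comp
      (D.differentiable_gram _)).const_mul _).differentiableOn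
  · rw [descentTerm, norm_mul]
    refine mul_le_mul_of_nonneg_left (hS _ (θ.differentiable_averagePow _ _) _ (fun A hA => ?_) _
      (hR (P.form j, M) (max_le_max (hC j) ?_))) (norm_nonneg _)
    · refine (θ.norm_averagePow_le ..).trans ?_
      push_cast
      gcongr
      exact hA.trans S.le_coe_toNNReal
    · linarith [norm_lt_of_mem_ball hM]

theorem exists_differentiable_comp_eq [FiniteDimensional ℂ W] (D : GramLift θ Q) {f : V → ℂ}
    (hf : Differentiable ℂ f) (hinv : ∀ u v, f (D.act u v) = f v) :
    ∃ F : W → ℂ, Differentiable ℂ F ∧ ∀ v, F (Q v) = f v := by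
  obtain ⟨P, hP, ⟨C, hC⟩, hmaj⟩ := PowerExpansion.exists_represents hf
  exact ⟨fun M => ∑' j, D.descentTerm P j M, differentiable_tsum_descentTerm hC hmaj,
    fun v => (hasSum_descentTerm hinv hP hC hmaj v).tsum_eq⟩

end GramLift

end Factorization

section Unitarization

open Polynomial

namespace StarAntiInvolution

section Constructions

variable {𝔸 : Type*} [Ring 𝔸] [StarRing 𝔸] [Algebra ℂ 𝔸]

/-- The transpose of matrices. -/
def transpose (m : Type*) [Fintype m] [DecidableEq m] :
    StarAntiInvolution (CStarMatrix m m ℂ) where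
  toFun A := A.transpose
  map_add' _ _ := rfl
  map_smul' _ _ := rfl
  map_mul' A B := Matrix.transpose_mul (CStarMatrix.ofMatrix.symm A) (CStarMatrix.ofMatrix.symm B)
  map_star' _ := rfl
  involutive' _ := rfl

/-- The anti-involution of `𝔸 × 𝔸` that exchanges the factors through `θ`; its unitary real form is
a copy of the whole unitary group of `𝔸`. -/
def prodSwap (θ : StarAntiInvolution 𝔸) : StarAntiInvolution (𝔸 × 𝔸) where
  toFun a := (θ a.2, θ a.1)
  map_add' a b := by simp
  map_smul' c a := by simp
  map_mul' a b := by simp [θ.map_mul]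
  map_star' a := by simp [Prod.ext_iff, θ.map_star]
  involutive' a := by simp [θ.apply_apply]

theorem prodSwap_apply (θ : StarAntiInvolution 𝔸) (a : 𝔸 × 𝔸) :
    θ.prodSwap a = (θ a.2, θ a.1) := rfl

/-- The twist of `θ` by a unitary `b`, which is again an involution since `θ b` is a scalar multiple
of `b`. For the transpose and a form `b` it is the adjoint with respect to `b`. -/
def twist [StarModule ℂ 𝔸] (θ : StarAntiInvolution 𝔸) {b : unitary 𝔸} {ε : unitary ℂ}
    (hb : θ b = (ε : ℂ) • (b : 𝔸)) : StarAntiInvolution 𝔸 where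
  toFun a := star (b : 𝔸) * θ a * b
  map_add' a c := by rw [map_add, mul_add, add_mul]
  map_smul' c a := by simp
  map_mul' a c := by
    have hbb := Unitary.coe_mul_star_self b
    calc star (b : 𝔸) * θ (a * c) * b = star (b : 𝔸) * θ c * (b * star (b : 𝔸)) * θ a * b := by
          rw [θ.map_mul, ← Unitary.coe_star, hbb, mul_one, mul_assoc _ (θ c)]
      _ = star (b : 𝔸) * θ c * b * (star (b : 𝔸) * θ a * b) := by simp only [mul_assoc]
  map_star' a := by simp [θ.map_star, mul_assoc]
  involutive' a := by
    have hε : star (ε : ℂ) * ε = 1 := Unitary.coe_star_mul_self ε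
    have hbb := Unitary.coe_star_mul_self b
    calc star (b : 𝔸) * θ (star (b : 𝔸) * θ a * b) * b
        = (star (ε : ℂ) * ε) • (star (b : 𝔸) * b * a * (star (b : 𝔸) * b)) := by
          simp only [θ.map_mul, θ.map_star, θ.apply_apply, hb, star_smul, mul_smul_comm,
            smul_mul_assoc, smul_smul, mul_assoc]
      _ = a := by rw [hε, hbb, one_smul, one_mul, mul_one]

theorem twist_apply [StarModule ℂ 𝔸] {θ : StarAntiInvolution 𝔸} {b : unitary 𝔸} {ε : unitary ℂ}
    (hb : θ b = (ε : ℂ) • (b : 𝔸)) (a : 𝔸) : θ.twist hb a = star (b : 𝔸) * θ a * b := rfl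

theorem semiconjBy_star_mul_self [StarModule ℂ 𝔸] {θ : StarAntiInvolution 𝔸} {b : 𝔸}
    {ε : unitary ℂ} (hb : θ b = (ε : ℂ) • b) :
    SemiconjBy b (star b * b) (θ (star b * b)) := by
  have hε : (ε : ℂ) * star (ε : ℂ) = 1 := Unitary.coe_mul_star_self ε
  rw [θ.map_mul, θ.map_star, hb, star_smul, smul_mul_smul_comm, hε, one_smul, SemiconjBy,
    mul_assoc]

theorem semiconjBy_aeval {θ : StarAntiInvolution 𝔸} {a b : 𝔸} (h : SemiconjBy b a (θ a))
    (p : ℝ[X]) : SemiconjBy b (aeval a p) (θ (aeval a p)) := by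
  have hpow : ∀ n, SemiconjBy b (a ^ n) (θ (a ^ n)) := fun n => by
    induction n with
    | zero => simp [θ.map_one]
    | succ n ih =>
      rw [pow_succ' a n, θ.map_mul, ← pow_succ', pow_succ]
      exact ih.mul_right h
  induction p using Polynomial.induction_on' with
  | add p q hp hq => simpa only [map_add] using hp.add_right hq
  | monomial n r =>
    rw [aeval_monomial, ← Algebra.smul_def, LinearMap.map_smul_of_tower]
    exact (hpow n).smul_right r

end Constructions

variable {𝔸 : Type*} [CStarAlgebra 𝔸] [FiniteDimensional ℂ 𝔸] {θ : StarAntiInvolution 𝔸}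

-- The witness is `(b⋆b)^(-1/4)`, which commutes past `b` up to `θ`, being a polynomial in `b⋆b`.
theorem exists_isUnit_mul_mul_mem_unitary {b : 𝔸} (hunit : IsUnit b) {ε : unitary ℂ}
    (hb : θ b = (ε : ℂ) • b) : ∃ g, IsUnit g ∧ θ g * b * g ∈ unitary 𝔸 := by
  obtain ⟨ι, _, Φ, l, hl, hspec, hΦ⟩ := exists_starAlgHom_pi_eq (IsSelfAdjoint.star_mul_self b)
  have hroot : ∀ i, ∃ r : ℝ, r ^ 4 * l i = 1 := fun i => by
    have hpos := pos_of_mem_spectrum_star_mul_self hunit (hspec i)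
    refine ⟨(√√(l i))⁻¹, ?_⟩
    rw [inv_pow, pow_mul _ 2 2, Real.sq_sqrt (Real.sqrt_nonneg _), Real.sq_sqrt hpos.le,
      inv_mul_cancel₀ hpos.ne']
  choose r hr using hroot
  set y : ι → ℂ := fun i => (r i : ℂ)
  have hstar : star (Φ y) = Φ y := by
    rw [← map_star]
    exact congrArg Φ (funext fun i => Complex.conj_ofReal _)
  have hy : y ^ 4 * (fun i => (l i : ℂ)) = 1 := funext fun i => by
    simpa [y] using congrArg ((↑) : ℝ → ℂ) (hr i)
  have hg : IsUnit (Φ y) := (IsUnit.of_mul_eq_one (y ^ 3 * fun i => (l i : ℂ))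
    (by linear_combination hy)).map Φ
  have hsemi : b * Φ y = θ (Φ y) * b := by
    obtain ⟨p, hp⟩ := exists_aeval_starAlgHom_eq (Φ := Φ) hl r
    rw [hΦ] at hp
    exact hp ▸ semiconjBy_aeval (semiconjBy_star_mul_self hb) p
  refine ⟨Φ y, hg, ?_⟩
  rw [← hsemi, ((hunit.mul hg).mul hg).mem_unitary_iff_star_mul_self]
  simp only [star_mul, hstar]
  calc Φ y * (Φ y * star b) * (b * Φ y * Φ y) = Φ (y * y * (fun i => (l i : ℂ)) * (y * y)) := by
        simp only [map_mul, hΦ, mul_assoc]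
    _ = Φ (y ^ 4 * fun i => (l i : ℂ)) := by ring_nf
    _ = 1 := by rw [hy, map_one]

end StarAntiInvolution

end Unitarization

section TraceDual

variable {m q V : Type*} [DecidableEq m] [DecidableEq q] [AddCommGroup V] [Module ℂ V]
  [TopologicalSpace V]

/-- The matrix representing the linear form `ℓ ∘ π` through the trace pairing. -/
noncomputable def traceDual (ℓ : V →L[ℂ] ℂ) (π : Matrix m q ℂ →ₗ[ℂ] V) : Matrix q m ℂ :=
  Matrix.of fun j i => ℓ (π (Matrix.single i j 1))

theorem trace_mul_traceDual [Fintype m] [Fintype q] (ℓ : V →L[ℂ] ℂ) (π : Matrix m q ℂ →ₗ[ℂ] V)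
    (Z : Matrix m q ℂ) : (Z * traceDual ℓ π).trace = ℓ (π Z) := by
  have hZ : Z = ∑ i, ∑ j, Z i j • Matrix.single i j 1 := by
    simpa [Matrix.smul_single] using Matrix.matrix_eq_sum_single Z
  conv_rhs => rw [hZ]
  simp only [map_sum, map_smul]
  simp [Matrix.trace, Matrix.mul_apply, traceDual]

@[fun_prop]
theorem continuous_traceDual [IsTopologicalAddGroup V] [ContinuousSMul ℂ V]
    (π : Matrix m q ℂ →ₗ[ℂ] V) : Continuous fun ℓ : V →L[ℂ] ℂ => traceDual ℓ π :=
  continuous_matrix fun j i => by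
    simp only [traceDual, Matrix.of_apply]
    fun_prop

end TraceDual

open scoped ComplexOrder
open CStarMatrix (ofMatrix)

section CStarMatrix

variable {m : Type*}

@[fun_prop]
theorem continuous_ofMatrix : Continuous (ofMatrix : Matrix m m ℂ → CStarMatrix m m ℂ) :=
  CStarMatrix.ofMatrixL.continuous

theorem differentiable_ofMatrix [Finite m] :
    Differentiable ℂ (ofMatrix : Matrix m m ℂ → CStarMatrix m m ℂ) := by
  have := Fintype.ofFinite m
  exact (CStarMatrix.ofMatrixL : Matrix m m ℂ ≃L[ℂ] CStarMatrix m m ℂ).differentiable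

instance [Finite m] : FiniteDimensional ℂ (CStarMatrix m m ℂ) :=
  Module.Finite.equiv CStarMatrix.ofMatrixₗ

variable [Fintype m]

theorem ofMatrix_mul (A B : Matrix m m ℂ) : ofMatrix (A * B) = ofMatrix A * ofMatrix B := rfl

/-- The trace as a continuous linear form. -/
noncomputable def cstarTrace : CStarMatrix m m ℂ →L[ℂ] ℂ :=
  LinearMap.toContinuousLinearMap
    (Matrix.traceLinearMap m ℂ ℂ ∘ₗ CStarMatrix.ofMatrixₗ.symm.toLinearMap)

theorem cstarTrace_ofMatrix (A : Matrix m m ℂ) : cstarTrace (ofMatrix A) = A.trace := rfl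

variable [DecidableEq m]

theorem transpose_ofMatrix (A : Matrix m m ℂ) :
    StarAntiInvolution.transpose m (ofMatrix A) = ofMatrix Aᵀ := rfl

/-- A unitary element of the C⋆-algebra of matrices as an invertible matrix. -/
def unitaryToGL : unitary (CStarMatrix m m ℂ) →* GL m ℂ :=
  (Units.map CStarMatrix.ofMatrixRingEquiv.symm.toMonoidHom).comp Unitary.toUnits

end CStarMatrix

section GeneralLinear

variable {n p : ℕ}

/-- The lifting data for `GL_n`: a linear form on `V` is a sum of two trace pairings, with `Lᵗ` and
with `L̃`. -/
noncomputable def GramLift.gl (n p : ℕ) :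
    GramLift (StarAntiInvolution.transpose (Fin n)).prodSwap (QGL (n := n) (p := p)) where
  functional := cstarTrace.coprod cstarTrace
  lift ℓ v := (ofMatrix (v.1ᵀ * (traceDual ℓ (.inl ℂ _ _))ᵀ),
    ofMatrix (v.2 * traceDual ℓ (.inr ℂ _ _)))
  act u v := gact (unitaryToGL ⟨u.1.1.2, congrArg Prod.snd u.1.2.1, congrArg Prod.snd u.1.2.2⟩) v
  gram ℓ M := (ofMatrix ((traceDual ℓ (.inr ℂ _ _))ᵀ * Mᵀ * (traceDual ℓ (.inl ℂ _ _))ᵀ),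
    ofMatrix (traceDual ℓ (.inl ℂ _ _) * M * traceDual ℓ (.inr ℂ _ _)))
  functional_lift ℓ v := by
    rw [ContinuousLinearMap.coprod_apply, cstarTrace_ofMatrix, cstarTrace_ofMatrix,
      trace_mul_traceDual, ← Matrix.transpose_mul, Matrix.trace_transpose, Matrix.trace_mul_comm,
      trace_mul_traceDual, ← map_add]
    simp
  lift_act ℓ u v := by
    set g := unitaryToGL ⟨u.1.1.2, congrArg Prod.snd u.1.2.1, congrArg Prod.snd u.1.2.2⟩
    have hu : u.1.1 = (ofMatrix (↑g⁻¹ : Matrix _ _ ℂ)ᵀ, ofMatrix (g : Matrix _ _ ℂ)) :=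
      Prod.ext (congrArg (StarAntiInvolution.transpose _) (congrArg Prod.snd u.2)) rfl
    change _ = u.1.1 * _
    rw [hu, Prod.mk_mul_mk, ← ofMatrix_mul, ← ofMatrix_mul, gact, transpose_mul, Matrix.mul_assoc,
      Matrix.mul_assoc]
  gram_apply ℓ v := by
    rw [StarAntiInvolution.prodSwap_apply, transpose_ofMatrix, transpose_ofMatrix, Prod.mk_mul_mk,
      ← ofMatrix_mul, ← ofMatrix_mul, QGL]
    simp only [transpose_mul, transpose_transpose, Matrix.mul_assoc]
  continuous_lift v := by fun_prop
  continuous_gram := by fun_prop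
  differentiable_gram ℓ := by
    refine (differentiable_ofMatrix.comp ?_).prodMk (differentiable_ofMatrix.comp ?_)
    · exact differentiable_matrix_mul (differentiable_matrix_mul (differentiable_const _)
        (differentiable_matrix_transpose differentiable_id)) (differentiable_const _)
    · exact differentiable_matrix_mul (differentiable_matrix_mul (differentiable_const _)
        differentiable_id) (differentiable_const _)

theorem exists_differentiable_comp_QGL {f : VSpace n p → ℂ} (hf : Differentiable ℂ f)
    (hinv : ∀ g v, f (gact g v) = f v) :
    ∃ F : Matrix (Fin p) (Fin p) ℂ → ℂ, Differentiable ℂ F ∧ ∀ v, F (QGL v) = f v :=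
  (GramLift.gl n p).exists_differentiable_comp_eq hf fun _ => hinv _

end GeneralLinear

section Isometry

variable {n p : ℕ} {β : Matrix (Fin n) (Fin n) ℂ} {ε : unitary ℂ}

/-- The columns `(L̃, β⁻¹ Lᵗ)` of a point `L ⊕ L̃`, on which the isometries of `β` act by left
multiplication. -/
noncomputable def columns (β : Matrix (Fin n) (Fin n) ℂ) (v : VSpace n p) :
    Matrix (Fin n) (Fin p ⊕ Fin p) ℂ := fromCols v.2 (β⁻¹ * v.1ᵀ)

/-- The inverse of `columns β`. -/
def ofColumns (β : Matrix (Fin n) (Fin n) ℂ) :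
    Matrix (Fin n) (Fin p ⊕ Fin p) ℂ →ₗ[ℂ] VSpace n p where
  toFun Z := ((β * Z.toCols₂)ᵀ, Z.toCols₁)
  map_add' Y Z := Prod.ext (by
    change (β * (Y.toCols₂ + Z.toCols₂))ᵀ = _
    rw [Matrix.mul_add, transpose_add]; rfl) rfl
  map_smul' c Z := Prod.ext (by
    change (β * (c • Z.toCols₂))ᵀ = _
    rw [Matrix.mul_smul, transpose_smul]; rfl) rfl

theorem ofColumns_columns (hdet : IsUnit β.det) (v : VSpace n p) :
    ofColumns β (columns β v) = v := by
  refine Prod.ext ?_ rfl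
  change (β * (β⁻¹ * v.1ᵀ))ᵀ = v.1
  rw [Matrix.mul_nonsing_inv_cancel_left _ _ hdet, transpose_transpose]

theorem columns_gact {g : GL (Fin n) ℂ} (hg : g ∈ isomGroup β) (hdet : IsUnit β.det)
    (v : VSpace n p) : columns β (gact g v) = (g : Matrix (Fin n) (Fin n) ℂ) * columns β v := by
  have hinv : β⁻¹ * (↑g⁻¹ : Matrix (Fin n) (Fin n) ℂ)ᵀ = (g : Matrix (Fin n) (Fin n) ℂ) * β⁻¹ := by
    have hg : (g : Matrix (Fin n) (Fin n) ℂ)ᵀ * β * (g : Matrix (Fin n) (Fin n) ℂ) = β := hg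
    have hgg : (↑g⁻¹ : Matrix (Fin n) (Fin n) ℂ)ᵀ * (g : Matrix (Fin n) (Fin n) ℂ)ᵀ = 1 := by
      rw [← transpose_mul, Units.mul_inv, transpose_one]
    calc β⁻¹ * (↑g⁻¹ : Matrix (Fin n) (Fin n) ℂ)ᵀ
        = β⁻¹ * (↑g⁻¹ : Matrix (Fin n) (Fin n) ℂ)ᵀ * (β * β⁻¹) := by
          rw [Matrix.mul_nonsing_inv _ hdet, Matrix.mul_one]
      _ = β⁻¹ * ((↑g⁻¹ : Matrix (Fin n) (Fin n) ℂ)ᵀ * (g : Matrix (Fin n) (Fin n) ℂ)ᵀ) * β * g *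
            β⁻¹ := by
          nth_rw 2 [← hg]
          simp only [Matrix.mul_assoc]
      _ = g * β⁻¹ := by
          rw [hgg, Matrix.mul_one, Matrix.nonsing_inv_mul _ hdet, Matrix.one_mul]
  rw [columns, columns, mul_fromCols, gact, transpose_mul, ← Matrix.mul_assoc, hinv,
    Matrix.mul_assoc]

theorem transpose_columns_mul_mul_columns (hβ : βᵀ = (ε : ℂ) • β) (hdet : IsUnit β.det)
    (v : VSpace n p) : (columns β v)ᵀ * β * columns β v =
      fromBlocks 0 1 (star (ε : ℂ) • 1) 0 * QMat β v := by
  have hβ' : β = star (ε : ℂ) • βᵀ := by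
    rw [hβ, smul_smul, Unitary.coe_star_mul_self, one_smul]
  have hinv : (β⁻¹)ᵀ * β = star (ε : ℂ) • 1 := by
    nth_rw 2 [hβ']
    rw [Matrix.mul_smul, ← transpose_mul, Matrix.mul_nonsing_inv _ hdet, transpose_one]
  have hrow : (β⁻¹ * v.1ᵀ)ᵀ * β = star (ε : ℂ) • v.1 := by
    rw [transpose_mul, transpose_transpose, Matrix.mul_assoc, hinv, Matrix.mul_smul, Matrix.mul_one]
  have hcol : v.2ᵀ * β * (β⁻¹ * v.1ᵀ) = v.2ᵀ * v.1ᵀ := by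
    rw [Matrix.mul_assoc, Matrix.mul_nonsing_inv_cancel_left _ _ hdet]
  rw [columns, transpose_fromCols, fromRows_mul, fromRows_mul_fromCols, hrow, hcol, QMat,
    fromBlocks_multiply]
  simp [Matrix.mul_assoc]

theorem transpose_ofMatrix_eq_smul (hβ : βᵀ = (ε : ℂ) • β) :
    StarAntiInvolution.transpose (Fin n) (ofMatrix β) = (ε : ℂ) • ofMatrix β :=
  congrArg ofMatrix hβ

/-- The adjoint `a ↦ β⁻¹ aᵗ β` with respect to a unitary form `β`. -/
def formAdjoint (hβ : βᵀ = (ε : ℂ) • β) (hu : ofMatrix β ∈ unitary (CStarMatrix _ _ ℂ)) :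
    StarAntiInvolution (CStarMatrix (Fin n) (Fin n) ℂ) :=
  (StarAntiInvolution.transpose (Fin n)).twist (b := ⟨ofMatrix β, hu⟩)
    (transpose_ofMatrix_eq_smul hβ)

theorem formAdjoint_ofMatrix (hβ : βᵀ = (ε : ℂ) • β)
    (hu : ofMatrix β ∈ unitary (CStarMatrix _ _ ℂ)) (A : Matrix (Fin n) (Fin n) ℂ) :
    formAdjoint hβ hu (ofMatrix A) = star (ofMatrix β) * ofMatrix (Aᵀ * β) := by
  rw [formAdjoint, StarAntiInvolution.twist_apply, transpose_ofMatrix, ofMatrix_mul, mul_assoc]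

theorem unitaryToGL_mem_isomGroup {hβ : βᵀ = (ε : ℂ) • β}
    {hu : ofMatrix β ∈ unitary (CStarMatrix _ _ ℂ)}
    (u : (formAdjoint hβ hu).realUnitary) : unitaryToGL u.1 ∈ isomGroup β := by
  set U : Matrix (Fin n) (Fin n) ℂ := (unitaryToGL u.1).val
  have hU : formAdjoint hβ hu (ofMatrix U) = star (ofMatrix U) :=
    StarAntiInvolution.mem_realForm.1 u.2
  have hUU : star (ofMatrix U) * ofMatrix U = 1 := Unitary.coe_star_mul_self u.1
  have h : ofMatrix (Uᵀ * β * U) = ofMatrix β :=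
    calc ofMatrix (Uᵀ * β * U)
        = ofMatrix β * (star (ofMatrix β) * ofMatrix (Uᵀ * β)) * ofMatrix U := by
          rw [← mul_assoc, Unitary.mul_star_self_of_mem hu, one_mul, ofMatrix_mul]
      _ = ofMatrix β := by rw [← formAdjoint_ofMatrix hβ hu, hU, mul_assoc, hUU, mul_one]
  exact ofMatrix.injective h

theorem isUnit_det_of_mem_unitary (hu : ofMatrix β ∈ unitary (CStarMatrix _ _ ℂ)) :
    IsUnit β.det :=
  (Matrix.isUnit_iff_isUnit_det β).1 <|
    ((Unitary.toUnits ⟨ofMatrix β, hu⟩).map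
      (CStarMatrix.ofMatrixRingEquiv (n := Fin n) (A := ℂ)).symm.toMonoidHom).isUnit

/-- The lifting data for the isometry group of a unitary form: a linear form on `V` is the trace
pairing of `columns β v` with a fixed matrix. -/
noncomputable def GramLift.isom (p : ℕ) (hβ : βᵀ = (ε : ℂ) • β)
    (hu : ofMatrix β ∈ unitary (CStarMatrix _ _ ℂ)) :
    GramLift (formAdjoint hβ hu) (QMat (p := p) β) where
  functional := cstarTrace
  lift ℓ v := ofMatrix (columns β v * traceDual ℓ (ofColumns β))
  act u v := gact (unitaryToGL u.1) v
  gram ℓ M := star (ofMatrix β) * ofMatrix ((traceDual ℓ (ofColumns β))ᵀ *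
    (fromBlocks 0 1 (star (ε : ℂ) • 1) 0 * M) * traceDual ℓ (ofColumns β))
  functional_lift ℓ v := by
    rw [cstarTrace_ofMatrix, trace_mul_traceDual, ofColumns_columns (isUnit_det_of_mem_unitary hu)]
  lift_act ℓ u v := by
    rw [columns_gact (unitaryToGL_mem_isomGroup u) (isUnit_det_of_mem_unitary hu), Matrix.mul_assoc]
    rfl
  gram_apply ℓ v := by
    rw [formAdjoint_ofMatrix, ← transpose_columns_mul_mul_columns hβ (isUnit_det_of_mem_unitary hu),
      mul_assoc, ← ofMatrix_mul]
    simp only [transpose_mul, Matrix.mul_assoc]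
  continuous_lift v := by fun_prop
  continuous_gram := by fun_prop
  differentiable_gram ℓ :=
    (differentiable_const _).mul <| differentiable_ofMatrix.comp <|
      differentiable_matrix_mul (differentiable_matrix_mul (differentiable_const _)
        (differentiable_matrix_mul (differentiable_const _) differentiable_id))
        (differentiable_const _)

theorem exists_differentiable_comp_QMat_of_mem_unitary (hβ : βᵀ = (ε : ℂ) • β)
    (hu : ofMatrix β ∈ unitary (CStarMatrix _ _ ℂ)) {f : VSpace n p → ℂ} (hf : Differentiable ℂ f)
    (hinv : ∀ g ∈ isomGroup β, ∀ v, f (gact g v) = f v) :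
    ∃ F : Matrix (Fin p ⊕ Fin p) (Fin p ⊕ Fin p) ℂ → ℂ,
      Differentiable ℂ F ∧ ∀ v, F (QMat β v) = f v :=
  (GramLift.isom p hβ hu).exists_differentiable_comp_eq hf fun u =>
    hinv _ (unitaryToGL_mem_isomGroup u)

theorem gact_gact (g h : GL (Fin n) ℂ) (v : VSpace n p) : gact g (gact h v) = gact (g * h) v := by
  simp [gact, Matrix.mul_assoc]

theorem one_gact (v : VSpace n p) : gact 1 v = v := by simp [gact]

theorem differentiable_gact (g : GL (Fin n) ℂ) :
    Differentiable ℂ fun v : VSpace n p => gact g v :=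
  (differentiable_matrix_mul differentiable_fst (differentiable_const _)).prodMk
    (differentiable_matrix_mul (differentiable_const _) differentiable_snd)

/-- The bilinear form `β(g x, g y)`. -/
def formPullback (g : GL (Fin n) ℂ) (β : Matrix (Fin n) (Fin n) ℂ) : Matrix (Fin n) (Fin n) ℂ :=
  (g : Matrix (Fin n) (Fin n) ℂ)ᵀ * β * (g : Matrix (Fin n) (Fin n) ℂ)

theorem mem_isomGroup {g : GL (Fin n) ℂ} : g ∈ isomGroup β ↔ formPullback g β = β := Iff.rfl

theorem formPullback_formPullback (g h : GL (Fin n) ℂ) (β : Matrix (Fin n) (Fin n) ℂ) :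
    formPullback h (formPullback g β) = formPullback (g * h) β := by
  simp [formPullback, Matrix.mul_assoc]

theorem transpose_formPullback (hβ : βᵀ = (ε : ℂ) • β) (g : GL (Fin n) ℂ) :
    (formPullback g β)ᵀ = (ε : ℂ) • formPullback g β := by
  simp [formPullback, hβ, Matrix.mul_assoc]

theorem QMat_gact (β : Matrix (Fin n) (Fin n) ℂ) (g : GL (Fin n) ℂ) (v : VSpace n p) :
    QMat β (gact g v) = QMat (formPullback g β) v := by
  rw [QMat, QMat, gact_mul, ← transpose_mul, ← transpose_mul, gact_mul, formPullback,
    Matrix.mul_inv_rev, Matrix.mul_inv_rev, ← transpose_nonsing_inv, ← Matrix.coe_units_inv]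
  simp only [gact, transpose_mul, Matrix.mul_assoc]

theorem mul_mul_inv_mem_isomGroup {g k : GL (Fin n) ℂ} (hk : k ∈ isomGroup (formPullback g β)) :
    g * k * g⁻¹ ∈ isomGroup β := by
  rw [mem_isomGroup, ← formPullback_formPullback, ← formPullback_formPullback, mem_isomGroup.1 hk,
    formPullback_formPullback, mul_inv_cancel, ← mem_isomGroup]
  exact one_mem _

theorem exists_formPullback_mem_unitary (hβ : βᵀ = (ε : ℂ) • β) (hdet : IsUnit β.det) :
    ∃ g : GL (Fin n) ℂ, ofMatrix (formPullback g β) ∈ unitary (CStarMatrix _ _ ℂ) := by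
  have hunit : IsUnit (ofMatrix β) :=
    ((Matrix.isUnit_iff_isUnit_det β).2 hdet).map
      (CStarMatrix.ofMatrixRingEquiv (n := Fin n) (A := ℂ))
  obtain ⟨g, hg, hgu⟩ := StarAntiInvolution.exists_isUnit_mul_mul_mem_unitary hunit
    (transpose_ofMatrix_eq_smul hβ)
  exact ⟨(hg.map (CStarMatrix.ofMatrixRingEquiv (n := Fin n) (A := ℂ)).symm).unit, hgu⟩

theorem exists_differentiable_comp_QMat (hβ : βᵀ = (ε : ℂ) • β) (hdet : IsUnit β.det)
    {f : VSpace n p → ℂ} (hf : Differentiable ℂ f)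
    (hinv : ∀ g ∈ isomGroup β, ∀ v, f (gact g v) = f v) :
    ∃ F : Matrix (Fin p ⊕ Fin p) (Fin p ⊕ Fin p) ℂ → ℂ,
      Differentiable ℂ F ∧ ∀ v, F (QMat β v) = f v := by
  obtain ⟨g, hg⟩ := exists_formPullback_mem_unitary hβ hdet
  have hinv' : ∀ k ∈ isomGroup (formPullback g β), ∀ v,
      f (gact g (gact k v)) = f (gact g v) := fun k hk v => by
    rw [← hinv _ (mul_mul_inv_mem_isomGroup hk) (gact g v), gact_gact, gact_gact,
      inv_mul_cancel_right]
  obtain ⟨F, hF, hFQ⟩ := exists_differentiable_comp_QMat_of_mem_unitary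
    (transpose_formPullback hβ g) hg (hf.comp (differentiable_gact g)) hinv'
  refine ⟨F, hF, fun v => ?_⟩
  have h := hFQ (gact g⁻¹ v)
  rwa [← QMat_gact, Function.comp_apply, gact_gact, mul_inv_cancel, one_gact] at h

end Isometry

theorem mainTheorem8 (n p : ℕ) :
    Function.Surjective (QstarGL n p) ∧
    (∀ (β : Matrix (Fin n) (Fin n) ℂ) (hs : βᵀ = β), IsUnit β.det →
      Function.Surjective (QstarO p β hs)) ∧
    (∀ (β : Matrix (Fin n) (Fin n) ℂ) (ha : βᵀ = -β) (hβ : IsUnit β.det),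
      Function.Surjective (QstarSp p β ha hβ)) := by
  refine ⟨fun f => ?_, fun β hs hβ f => ?_, fun β ha hβ f => ?_⟩
  · obtain ⟨F, hF, hFf⟩ := exists_differentiable_comp_QGL f.2.1 fun g => f.2.2 g trivial
    exact ⟨⟨F, hF⟩, Subtype.ext (funext hFf)⟩
  · obtain ⟨F, hF, hFf⟩ := exists_differentiable_comp_QMat (ε := 1) (by simpa using hs) hβ
      f.2.1 f.2.2
    exact ⟨⟨fun w => F w, hF.comp (SymB (formS p)).subtypeL.differentiable⟩,
      Subtype.ext (funext hFf)⟩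
  · obtain ⟨F, hF, hFf⟩ := exists_differentiable_comp_QMat (ε := -1)
      (by simpa [Unitary.coe_neg] using ha) hβ f.2.1 f.2.2
    exact ⟨⟨fun w => F w, hF.comp (SymB (formA p)).subtypeL.differentiable⟩,
      Subtype.ext (funext hFf)⟩
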